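/- A \emph{tracial von Neumann algebra} is a unital C$^*$-algebra $N$ with a faithful tracial state $\tau$ such that the closed unit ball of $N$ is complete in the norm $\|a\|_{2,\tau}=\tau(a^*a)^{1/2}$. A \emph{II$_1$ factor} is an infinite-dimensional tracial von Neumann algebra $(M,\tau)$ with centre $\mathbb{C}1$. The \emph{$u$-topology} on the group $\mathrm{Aut}(M)$ of all $*$-automorphisms of $M$ is the topology generated by the seminorms $T\mapsto\|\varphi\circ T\|$, where $\varphi$ runs over the predual $M_*$ ($\sigma$-weakly continuous functionals on $M$). Let $X$ be a compact Hausdorff space. A (tracially continuous) \emph{W$^*$-bundle} over $X$ is a unital C$^*$-algebra $\mathcal{M}$ with a unital embedding of $C(X)$ into the centre of $\mathcal{M}$ and a conditional expectation $E:\mathcal{M}\to C(X)$ such that $E(ab)=E(ba)$ for all $a,b\in\mathcal{M}$, $E(a^*a)=0$ implies $a=0$, and the closed unit ball of $\mathcal{M}$ is complete in the norm $\|a\|_{2,u}=\|E(a^*a)^{1/2}\|$. A morphism of W$^*$-bundles (over possibly different bases $X_1,X_2$) is a unital $*$-homomorphism $\alpha:\mathcal{M}_1\to\mathcal{M}_2$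 with $\alpha(C(X_1))\subseteq C(X_2)$ and $\alpha\circ E_1=E_2\circ\alpha$; an isomorphism is a morphism with an inverse morphism. For a tracial von Neumann algebra $(N,\tau)$, the \emph{trivial bundle} $C_\sigma(X,N)$ is the algebra of norm-bounded, $\|\cdot\|_{2,\tau}$-continuous functions $X\to N$, with $C(X)$ embedded by $f\mapsto f(\cdot)1_N$ and $E(a)=\tau\circ a$. For $Y\subseteq X$ closed, the restriction $\mathcal{M}_Y$ is the quotient of $\mathcal{M}$ by $I_Y=\{a: E(a^*a)(x)=0\ \forall x\in Y\}$, with the induced embedding of $C(Y)$ and the induced conditional expectation onto $C(Y)$; the fibre at $x\in X$ is $\mathcal{M}_x=\mathcal{M}/I_{\{x\}}$. The bundle $\mathcal{M}$ is \emph{locally trivial} if every $x\in X$ has a closed neighbourhood $Y$ such that $\mathcal{M}_Y$ is isomorphic to $C_\sigma(Y,N)$ for some tracial von Neumann algebra $N$. \textbf{Corollary 4.8.} Let $M$ be a II$_1$ factor such that $\mathrm{Aut}(M)$ is contractible in the $u$-topology. Let $\mathcal{M}$ be a locally trivial W$^*$-bundle over a compact Hausdorff space $X$ all of whose fibres are $*$-isomorphic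 to $M$. Then $\mathcal{M}$ is trivial: it is isomorphic, as a W$^*$-bundle, to $C_\sigma(X,M)$. -/

import Mathlib

open scoped ComplexOrder InnerProductSpace Topology
open TopologicalSpace Filter

/-! ## Positive functionals and the associated 2-seminorm -/

section PositiveFunctional

variable {A : Type*} [CStarAlgebra A]

/-- A linear functional with `φ (a* a) ≥ 0` for all `a`, as a bundled positive linear map for the
canonical order of the C*-algebra. -/
noncomputable def posFunctional (φ : A →ₗ[ℂ] ℂ) (hφ : ∀ a, 0 ≤ φ (star a * a)) :
    letI := CStarAlgebra.spectralOrder A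
    A →ₚ[ℂ] ℂ :=
  letI := CStarAlgebra.spectralOrder A
  letI := CStarAlgebra.spectralOrderedRing A
  PositiveLinearMap.mk₀ φ fun a ha => by
    obtain ⟨b, rfl⟩ := CStarAlgebra.nonneg_iff_eq_star_mul_self.mp ha
    exact hφ b

/-- `‖a‖_{2,φ} = φ(a* a)^{1/2}`. -/
noncomputable def twoNorm (φ : A →ₗ[ℂ] ℂ) (a : A) : ℝ := √(φ (star a * a)).re

theorem twoNorm_nonneg (φ : A →ₗ[ℂ] ℂ) (a : A) : 0 ≤ twoNorm φ a := Real.sqrt_nonneg _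

theorem twoNorm_zero (φ : A →ₗ[ℂ] ℂ) : twoNorm φ 0 = 0 := by simp [twoNorm]

theorem twoNorm_neg (φ : A →ₗ[ℂ] ℂ) (a : A) : twoNorm φ (-a) = twoNorm φ a := by simp [twoNorm]

theorem twoNorm_star (φ : A →ₗ[ℂ] ℂ) (ht : ∀ a b, φ (a * b) = φ (b * a)) (a : A) :
    twoNorm φ (star a) = twoNorm φ a := by
  simp [twoNorm, ht a (star a)]

theorem twoNorm_add_le (φ : A →ₗ[ℂ] ℂ) (hφ : ∀ a, 0 ≤ φ (star a * a)) (a b : A) :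
    twoNorm φ (a + b) ≤ twoNorm φ a + twoNorm φ b := by
  let _ := CStarAlgebra.spectralOrder A
  let _ := CStarAlgebra.spectralOrderedRing A
  exact norm_add_le ((posFunctional φ hφ).toPreGNS a) ((posFunctional φ hφ).toPreGNS b)

theorem norm_apply_star_mul_le (φ : A →ₗ[ℂ] ℂ) (hφ : ∀ a, 0 ≤ φ (star a * a)) (a b : A) :
    ‖φ (star a * b)‖ ≤ twoNorm φ a * twoNorm φ b := by
  let _ := CStarAlgebra.spectralOrder A
  let _ := CStarAlgebra.spectralOrderedRing A
  exact norm_inner_le_norm (𝕜 := ℂ)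
    ((posFunctional φ hφ).toPreGNS a) ((posFunctional φ hφ).toPreGNS b)

theorem twoNorm_mul_le (φ : A →ₗ[ℂ] ℂ) (hφ : ∀ a, 0 ≤ φ (star a * a)) (a b : A) :
    twoNorm φ (a * b) ≤ ‖a‖ * twoNorm φ b := by
  let _ := CStarAlgebra.spectralOrder A
  let _ := CStarAlgebra.spectralOrderedRing A
  have h := ((posFunctional φ hφ).leftMulMapPreGNS a).le_of_opNorm_le
    (LinearMap.mkContinuous_norm_le _ (norm_nonneg a) _) ((posFunctional φ hφ).toPreGNS b)
  exact h

theorem twoNorm_mul_le' (φ : A →ₗ[ℂ] ℂ) (hφ : ∀ a, 0 ≤ φ (star a * a))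
    (ht : ∀ a b, φ (a * b) = φ (b * a)) (a b : A) :
    twoNorm φ (a * b) ≤ twoNorm φ a * ‖b‖ := by
  rw [← twoNorm_star φ ht, star_mul, mul_comm]
  simpa [twoNorm_star φ ht] using twoNorm_mul_le φ hφ (star b) (star a)

theorem apply_star_mul_self_eq_zero_iff (φ : A →ₗ[ℂ] ℂ) (hφ : ∀ a, 0 ≤ φ (star a * a)) (a : A) :
    φ (star a * a) = 0 ↔ twoNorm φ a = 0 := by
  have h := hφ a
  rw [Complex.le_def] at h
  rw [twoNorm, Real.sqrt_eq_zero h.1, Complex.ext_iff]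
  simpa using fun _ => h.2.symm

end PositiveFunctional

/-! ## Tracial von Neumann algebras -/

/-- A tracial von Neumann algebra, viewed abstractly: a unital C*-algebra `N` with a faithful
tracial state `τ` such that the closed unit ball of `N` is complete for `‖·‖_{2,τ}`. -/
structure TracialVNA (N : Type*) [CStarAlgebra N] where
  tr : N →ₗ[ℂ] ℂ
  tr_one : tr 1 = 1
  tr_nonneg : ∀ a, 0 ≤ tr (star a * a)
  tr_mul_comm : ∀ a b, tr (a * b) = tr (b * a)
  faithful : ∀ a, tr (star a * a) = 0 → a = 0
  complete : ∀ u : ℕ → N, (∀ n, ‖u n‖ ≤ 1) →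
    (∀ ε > 0, ∃ n₀, ∀ m ≥ n₀, ∀ n ≥ n₀, twoNorm tr (u m - u n) < ε) →
    ∃ a, ‖a‖ ≤ 1 ∧ Tendsto (fun n => twoNorm tr (u n - a)) atTop (𝓝 0)

namespace TracialVNA

variable {M : Type*} [CStarAlgebra M]

/-- `(M, τ)` is a II₁ factor: an infinite-dimensional tracial von Neumann algebra with trivial
centre. -/
structure IsII1Factor (_τ : TracialVNA M) : Prop where
  factor : ∀ z : M, (∀ a, z * a = a * z) → ∃ c : ℂ, z = algebraMap ℂ M c
  infinite : ¬ FiniteDimensional ℂ M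

/-- The trace as a positive linear map. -/
noncomputable def positiveTrace (τ : TracialVNA M) :
    letI := CStarAlgebra.spectralOrder M
    M →ₚ[ℂ] ℂ :=
  posFunctional τ.tr τ.tr_nonneg

/-- The predual `M_*`: the functionals on `M` that are σ-weakly continuous for the standard (GNS)
representation `π` of `M` on `L²(M, τ)`, that is, the functionals `a ↦ ∑ₙ ⟪ηₙ, π(a) ξₙ⟫` with
`∑ₙ ‖ξₙ‖² < ∞` and `∑ₙ ‖ηₙ‖² < ∞`. -/
def predual (τ : TracialVNA M) : Set (StrongDual ℂ M) :=
  letI := CStarAlgebra.spectralOrder M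
  letI := CStarAlgebra.spectralOrderedRing M
  {φ | ∃ ξ η : ℕ → τ.positiveTrace.GNS,
    Summable (fun n => ‖ξ n‖ ^ 2) ∧ Summable (fun n => ‖η n‖ ^ 2) ∧
    ∀ a, HasSum (fun n => ⟪η n, τ.positiveTrace.gnsStarAlgHom a (ξ n)⟫_ℂ) (φ a)}

/-- The functional `φ ∘ α`, for a *-automorphism `α` (which is automatically isometric). -/
noncomputable def precomp (φ : StrongDual ℂ M) (α : M ≃⋆ₐ[ℂ] M) : StrongDual ℂ M :=
  φ.comp
    ({ toFun := α
       map_add' := map_add α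
       map_smul' := map_smul α
       cont := (StarAlgEquiv.isometry α).continuous } : M →L[ℂ] M)

/-- The `u`-topology on `Aut(M)`: the topology generated by the seminorms `T ↦ ‖φ ∘ T‖` for
`φ ∈ M_*`, that is, the coarsest one making all maps `α ↦ φ ∘ α` into `(M*, ‖·‖)` continuous. -/
noncomputable abbrev uTopology (τ : TracialVNA M) : TopologicalSpace (M ≃⋆ₐ[ℂ] M) :=
  ⨅ φ ∈ τ.predual, TopologicalSpace.induced (precomp φ) inferInstance

end TracialVNA

/-! ## W*-bundles -/

/-- The data underlying a W*-bundle over `X` with section algebra `A`: a unital *-homomorphism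
`ι : C(X) → A` and a linear map `E : A → C(X)`. -/
structure BundleData (X A : Type*) [TopologicalSpace X] [Ring A] [StarRing A] [Algebra ℂ A] where
  ι : C(X, ℂ) →⋆ₐ[ℂ] A
  E : A →ₗ[ℂ] C(X, ℂ)

namespace BundleData

variable {X₁ A₁ X₂ A₂ : Type*} [TopologicalSpace X₁] [Ring A₁] [StarRing A₁] [Algebra ℂ A₁]
  [TopologicalSpace X₂] [Ring A₂] [StarRing A₂] [Algebra ℂ A₂]

/-- Morphisms of bundles: unital *-homomorphisms `α` with `α(C(X₁)) ⊆ C(X₂)` that intertwine the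
conditional expectations. -/
structure IsMorphism (D₁ : BundleData X₁ A₁) (D₂ : BundleData X₂ A₂) (α : A₁ →⋆ₐ[ℂ] A₂) :
    Prop where
  map_base : ∀ f, ∃ g, α (D₁.ι f) = D₂.ι g
  map_E : ∀ a, α (D₁.ι (D₁.E a)) = D₂.ι (D₂.E (α a))

/-- Isomorphism of bundles: there are mutually inverse morphisms. -/
def Isomorphic (D₁ : BundleData X₁ A₁) (D₂ : BundleData X₂ A₂) : Prop :=
  ∃ (α : A₁ →⋆ₐ[ℂ] A₂) (β : A₂ →⋆ₐ[ℂ] A₁), IsMorphism D₁ D₂ α ∧ IsMorphism D₂ D₁ β ∧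
    β.comp α = StarAlgHom.id ℂ A₁ ∧ α.comp β = StarAlgHom.id ℂ A₂

end BundleData

/-- A tracially continuous W*-bundle over the compact Hausdorff space `X` whose section algebra is
the unital C*-algebra `A`: a central unital embedding `ι` of `C(X)` (injective because of `E_ι`), and
a conditional expectation `E` onto `C(X)`, i.e. a positive `C(X)`-bimodule projection, which is
tracial and faithful, and for which the closed unit ball of `A` is complete with respect to
`‖a‖_{2,u} = ‖E(a* a)^{1/2}‖ = ‖E(a* a)‖^{1/2}`. -/
structure WStarBundle (X A : Type*) [TopologicalSpace X] [CompactSpace X] [T2Space X]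
    [CStarAlgebra A] extends BundleData X A where
  ι_central : ∀ f a, ι f * a = a * ι f
  E_ι : ∀ f, E (ι f) = f
  E_ι_mul : ∀ f a, E (ι f * a) = f * E a
  E_nonneg : ∀ a x, 0 ≤ E (star a * a) x
  E_mul_comm : ∀ a b, E (a * b) = E (b * a)
  faithful : ∀ a, E (star a * a) = 0 → a = 0
  complete : ∀ u : ℕ → A, (∀ n, ‖u n‖ ≤ 1) →
    (∀ ε > 0, ∃ n₀, ∀ m ≥ n₀, ∀ n ≥ n₀, √‖E (star (u m - u n) * (u m - u n))‖ < ε) →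
    ∃ a, ‖a‖ ≤ 1 ∧ Tendsto (fun n => √‖E (star (u n - a) * (u n - a))‖) atTop (𝓝 0)

/-! ### Trivial bundles -/

section Trivial

variable (X : Type*) [TopologicalSpace X] {N : Type*} [CStarAlgebra N]

/-- `C_σ(X, N)`: the *-algebra of norm-bounded, `‖·‖_{2,τ}`-continuous functions `X → N`. -/
noncomputable def CSigma (τ : TracialVNA N) : StarSubalgebra ℂ (X → N) where
  carrier := {f | (∃ C, ∀ x, ‖f x‖ ≤ C) ∧
    ∀ x₀, Tendsto (fun x => twoNorm τ.tr (f x - f x₀)) (𝓝 x₀) (𝓝 0)}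
  mul_mem' := by
    rintro f g ⟨⟨C, hC⟩, hf⟩ ⟨⟨D, hD⟩, hg⟩
    refine ⟨⟨C * D, fun x => (norm_mul_le _ _).trans ?_⟩, fun x₀ => ?_⟩
    · exact mul_le_mul (hC x) (hD x) (norm_nonneg _) ((norm_nonneg _).trans (hC x))
    · have h : Tendsto (fun x => C * twoNorm τ.tr (g x - g x₀) + twoNorm τ.tr (f x - f x₀) * D)
          (𝓝 x₀) (𝓝 0) := by
        simpa using ((hg x₀).const_mul C).add ((hf x₀).mul_const D)
      refine squeeze_zero (fun _ => twoNorm_nonneg _ _) (fun x => ?_) h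
      have e : (f * g) x - (f * g) x₀ = f x * (g x - g x₀) + (f x - f x₀) * g x₀ := by
        simp only [Pi.mul_apply]; noncomm_ring
      rw [e]
      refine (twoNorm_add_le _ τ.tr_nonneg _ _).trans (add_le_add ?_ ?_)
      · exact (twoNorm_mul_le _ τ.tr_nonneg _ _).trans
          (mul_le_mul_of_nonneg_right (hC x) (twoNorm_nonneg _ _))
      · exact (twoNorm_mul_le' _ τ.tr_nonneg τ.tr_mul_comm _ _).trans
          (mul_le_mul_of_nonneg_left (hD x₀) (twoNorm_nonneg _ _))
  add_mem' := by
    rintro f g ⟨⟨C, hC⟩, hf⟩ ⟨⟨D, hD⟩, hg⟩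
    refine ⟨⟨C + D, fun x => (norm_add_le _ _).trans (add_le_add (hC x) (hD x))⟩, fun x₀ => ?_⟩
    refine squeeze_zero (fun _ => twoNorm_nonneg _ _) (fun x => ?_)
      (by simpa using (hf x₀).add (hg x₀))
    have e : (f + g) x - (f + g) x₀ = (f x - f x₀) + (g x - g x₀) := by
      simp only [Pi.add_apply]; abel
    rw [e]
    exact twoNorm_add_le _ τ.tr_nonneg _ _
  algebraMap_mem' c := by
    refine ⟨⟨‖algebraMap ℂ N c‖, fun x => le_rfl⟩, fun x₀ => ?_⟩
    simp [twoNorm_zero]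
  star_mem' := by
    rintro f ⟨⟨C, hC⟩, hf⟩
    refine ⟨⟨C, fun x => by simpa using hC x⟩, fun x₀ => ?_⟩
    simpa [← star_sub, twoNorm_star _ τ.tr_mul_comm] using hf x₀

variable {X}

theorem TracialVNA.continuous_tr_comp (τ : TracialVNA N) (a : CSigma X τ) :
    Continuous fun x => τ.tr (a.1 x) := by
  refine continuous_iff_continuousAt.mpr fun x₀ => ?_
  refine tendsto_iff_norm_sub_tendsto_zero.mpr ?_
  have h := (a.2.2 x₀).const_mul (twoNorm τ.tr 1)
  rw [mul_zero] at h
  refine squeeze_zero (fun _ => norm_nonneg _) (fun x => ?_) h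
  simpa using norm_apply_star_mul_le τ.tr τ.tr_nonneg 1 (a.1 x - a.1 x₀)

variable [CompactSpace X]

theorem TracialVNA.smul_one_mem (τ : TracialVNA N) (f : C(X, ℂ)) :
    (fun x => algebraMap ℂ N (f x)) ∈ CSigma X τ := by
  refine ⟨⟨‖f‖ * ‖(1 : N)‖, fun x => ?_⟩, fun x₀ => ?_⟩
  · rw [norm_algebraMap]
    exact mul_le_mul_of_nonneg_right (f.norm_coe_le_norm x) (norm_nonneg _)
  · have h : Tendsto (fun x => ‖algebraMap ℂ N (f x) - algebraMap ℂ N (f x₀)‖ * twoNorm τ.tr 1)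
        (𝓝 x₀) (𝓝 0) := by
      have hc : Continuous fun x => algebraMap ℂ N (f x) :=
        (algebraMapCLM ℂ N).continuous.comp f.continuous
      simpa using (tendsto_iff_norm_sub_tendsto_zero.mp (hc.tendsto x₀)).mul_const _
    refine squeeze_zero (fun _ => twoNorm_nonneg _ _) (fun x => ?_) h
    simpa using twoNorm_mul_le τ.tr τ.tr_nonneg (algebraMap ℂ N (f x) - algebraMap ℂ N (f x₀)) 1

variable (X)

/-- The trivial W*-bundle `C_σ(X, N)` over `X` with fibre `(N, τ)`:
`ι(f)(x) = f(x) 1` and `E(a) = τ ∘ a`. -/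
noncomputable def trivialBundle (τ : TracialVNA N) : BundleData X (CSigma X τ) where
  ι :=
    { toFun := fun f => ⟨fun x => algebraMap ℂ N (f x), τ.smul_one_mem f⟩
      map_one' := by ext; simp
      map_mul' := fun f g => by ext; simp
      map_zero' := by ext; simp
      map_add' := fun f g => by ext; simp
      commutes' := fun c => by ext; simp
      map_star' := fun f => by ext x; exact algebraMap_star_comm (f x) }
  E :=
    { toFun := fun a => ⟨fun x => τ.tr (a.1 x), τ.continuous_tr_comp a⟩
      map_add' := fun a b => by ext; simp
      map_smul' := fun c a => by ext; simp }

end Trivial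

/-! ### Restrictions, fibres, local triviality -/

/-- A closed subset of a compact space is compact. -/
instance instCompactSpaceCloseds {X : Type*} [TopologicalSpace X] [CompactSpace X]
    (Y : Closeds X) : CompactSpace Y :=
  isCompact_iff_compactSpace.mp Y.isClosed.isCompact

namespace WStarBundle

variable {X A : Type*} [TopologicalSpace X] [CompactSpace X] [T2Space X] [CStarAlgebra A]

/-- The trace `a ↦ E(a)(x)`. -/
noncomputable def evalTr (𝓜 : WStarBundle X A) (x : X) : A →ₗ[ℂ] ℂ where
  toFun a := 𝓜.E a x
  map_add' a b := by simp
  map_smul' c a := by simp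

/-- The two-sided ideal `I_Y = {a | E(a* a)(x) = 0 for all x ∈ Y}`. -/
noncomputable def idealOn (𝓜 : WStarBundle X A) (Y : Set X) : Ideal A where
  carrier := {a | ∀ x ∈ Y, 𝓜.E (star a * a) x = 0}
  zero_mem' := by simp
  add_mem' := by
    intro a b ha hb x hx
    have h1 := (apply_star_mul_self_eq_zero_iff (𝓜.evalTr x) (𝓜.E_nonneg · x) a).mp (ha x hx)
    have h2 := (apply_star_mul_self_eq_zero_iff (𝓜.evalTr x) (𝓜.E_nonneg · x) b).mp (hb x hx)
    refine (apply_star_mul_self_eq_zero_iff (𝓜.evalTr x) (𝓜.E_nonneg · x) (a + b)).mpr ?_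
    refine le_antisymm ?_ (twoNorm_nonneg _ _)
    simpa [h1, h2] using twoNorm_add_le (𝓜.evalTr x) (𝓜.E_nonneg · x) a b
  smul_mem' := by
    intro c a ha x hx
    have h1 := (apply_star_mul_self_eq_zero_iff (𝓜.evalTr x) (𝓜.E_nonneg · x) a).mp (ha x hx)
    refine (apply_star_mul_self_eq_zero_iff (𝓜.evalTr x) (𝓜.E_nonneg · x) (c • a)).mpr ?_
    refine le_antisymm ?_ (twoNorm_nonneg _ _)
    simpa [h1] using twoNorm_mul_le (𝓜.evalTr x) (𝓜.E_nonneg · x) c a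

theorem mem_idealOn (𝓜 : WStarBundle X A) (Y : Set X) (a : A) :
    a ∈ 𝓜.idealOn Y ↔ ∀ x ∈ Y, 𝓜.E (star a * a) x = 0 := Iff.rfl

theorem star_mem_idealOn (𝓜 : WStarBundle X A) (Y : Set X) {a : A} (ha : a ∈ 𝓜.idealOn Y) :
    star a ∈ 𝓜.idealOn Y := by
  intro x hx
  rw [star_star, 𝓜.E_mul_comm]
  exact ha x hx

instance instIsTwoSidedIdealOn (𝓜 : WStarBundle X A) (Y : Set X) : (𝓜.idealOn Y).IsTwoSided where
  mul_mem_of_left {a} b ha := by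
    have h := (𝓜.idealOn Y).mul_mem_left (star b) (𝓜.star_mem_idealOn Y ha)
    simpa using 𝓜.star_mem_idealOn Y h

theorem E_eq_zero_of_mem_idealOn (𝓜 : WStarBundle X A) (Y : Set X) {a : A}
    (ha : a ∈ 𝓜.idealOn Y) {x : X} (hx : x ∈ Y) : 𝓜.E a x = 0 := by
  have h1 := (apply_star_mul_self_eq_zero_iff (𝓜.evalTr x) (𝓜.E_nonneg · x) a).mp (ha x hx)
  have h2 := norm_apply_star_mul_le (𝓜.evalTr x) (𝓜.E_nonneg · x) 1 a
  rw [h1, mul_zero, star_one, one_mul] at h2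
  exact norm_le_zero_iff.mp h2

/-- The section algebra `𝓜_Y = 𝓜 / I_Y` of the restriction of `𝓜` to `Y`. -/
abbrev Restr (𝓜 : WStarBundle X A) (Y : Set X) : Type _ := A ⧸ 𝓜.idealOn Y

/-- The involution of `𝓜_Y`, induced by that of `𝓜`. -/
noncomputable instance instStarRingRestr (𝓜 : WStarBundle X A) (Y : Set X) :
    StarRing (𝓜.Restr Y) where
  star := Quotient.map' star fun a b h => by
    rw [Submodule.quotientRel_def] at h ⊢
    simpa using 𝓜.star_mem_idealOn Y h
  star_involutive := by
    rintro ⟨a⟩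
    exact congrArg (Ideal.Quotient.mk (𝓜.idealOn Y)) (star_star a)
  star_mul := by
    rintro ⟨a⟩ ⟨b⟩
    exact congrArg (Ideal.Quotient.mk (𝓜.idealOn Y)) (star_mul a b)
  star_add := by
    rintro ⟨a⟩ ⟨b⟩
    exact congrArg (Ideal.Quotient.mk (𝓜.idealOn Y)) (star_add a b)

/-- The fibre `𝓜_x = 𝓜 / I_x`, `I_x = {a | E(a* a)(x) = 0}`. -/
abbrev Fibre (𝓜 : WStarBundle X A) (x : X) : Type _ := 𝓜.Restr {x}

/-- A continuous extension to `X` of a continuous function on the closed subset `Y`. -/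
noncomputable def extend (Y : Closeds X) (g : C(Y, ℂ)) : C(X, ℂ) :=
  (ContinuousMap.exists_restrict_eq Y.isClosed g).choose

theorem extend_apply (Y : Closeds X) (g : C(Y, ℂ)) (y : Y) : extend Y g y = g y :=
  DFunLike.congr_fun (ContinuousMap.exists_restrict_eq Y.isClosed g).choose_spec y

theorem mk_ι_eq (𝓜 : WStarBundle X A) (Y : Closeds X) {f₁ f₂ : C(X, ℂ)}
    (h : ∀ y : Y, f₁ y = f₂ y) :
    Ideal.Quotient.mk (𝓜.idealOn Y) (𝓜.ι f₁) = Ideal.Quotient.mk (𝓜.idealOn Y) (𝓜.ι f₂) := by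
  rw [Ideal.Quotient.eq]
  intro x hx
  rw [← map_sub, ← map_star, ← map_mul, 𝓜.E_ι]
  simp [h ⟨x, hx⟩]

/-- The restriction of the bundle `𝓜` to the closed subset `Y`. Its section algebra is `𝓜 / I_Y`;
the embedding of `C(Y)` sends `f|_Y` to the class of `f`, and the conditional expectation sends the
class of `a` to `E(a)|_Y`. -/
noncomputable def restrict (𝓜 : WStarBundle X A) (Y : Closeds X) :
    BundleData Y (𝓜.Restr Y) where
  ι :=
    { toFun := fun g => Ideal.Quotient.mk (𝓜.idealOn Y) (𝓜.ι (extend Y g))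
      map_one' := by
        rw [← map_one (Ideal.Quotient.mk (𝓜.idealOn Y)), ← map_one 𝓜.ι]
        exact 𝓜.mk_ι_eq Y fun y => by simp [extend_apply]
      map_mul' := fun g h => by
        rw [← map_mul, ← map_mul]
        exact 𝓜.mk_ι_eq Y fun y => by simp [extend_apply]
      map_zero' := by
        rw [← map_zero (Ideal.Quotient.mk (𝓜.idealOn Y)), ← map_zero 𝓜.ι]
        exact 𝓜.mk_ι_eq Y fun y => by simp [extend_apply]
      map_add' := fun g h => by
        rw [← map_add, ← map_add]
        exact 𝓜.mk_ι_eq Y fun y => by simp [extend_apply]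
      commutes' := fun c => by
        have e : algebraMap ℂ (𝓜.Restr Y) c =
            Ideal.Quotient.mk (𝓜.idealOn Y) (𝓜.ι (algebraMap ℂ C(X, ℂ) c)) := by
          rw [AlgHomClass.commutes]; rfl
        rw [e]
        exact 𝓜.mk_ι_eq Y fun y => by simp [extend_apply]
      map_star' := fun g => by
        have e : star (Ideal.Quotient.mk (𝓜.idealOn Y) (𝓜.ι (extend Y g))) =
            Ideal.Quotient.mk (𝓜.idealOn Y) (𝓜.ι (star (extend Y g))) := by
          rw [map_star]; rfl
        rw [e]
        exact 𝓜.mk_ι_eq Y fun y => by simp [extend_apply] }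
  E :=
    { toFun := Quotient.lift (fun a => (𝓜.E a).restrict (Y : Set X)) fun a b h => by
        have h' : a - b ∈ 𝓜.idealOn Y := (Submodule.quotientRel_def _).mp h
        ext y
        have := 𝓜.E_eq_zero_of_mem_idealOn Y h' y.2
        rw [map_sub, ContinuousMap.sub_apply] at this
        exact sub_eq_zero.mp this
      map_add' := by
        rintro ⟨a⟩ ⟨b⟩
        ext y
        exact DFunLike.congr_fun (map_add 𝓜.E a b) (y : X)
      map_smul' := by
        rintro c ⟨a⟩
        ext y
        exact DFunLike.congr_fun (map_smul 𝓜.E c a) (y : X) }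

end WStarBundle

/-- The bundle `𝓜` is locally trivial: every point of `X` has a closed neighbourhood `Y` such that
`𝓜_Y` is isomorphic to a trivial bundle over `Y`, with some tracial von Neumann algebra `N` as its
fibre. (Such an `N` embeds in the quotient `𝓜_Y` of `A` as the constant sections, so nothing is lost
by taking it in the universe of `A`.) -/
def WStarBundle.IsLocallyTrivial.{u, v} {X : Type v} {A : Type u} [TopologicalSpace X]
    [CompactSpace X] [T2Space X] [CStarAlgebra A] (𝓜 : WStarBundle X A) : Prop :=
  ∀ x : X, ∃ Y : Closeds X, (Y : Set X) ∈ 𝓝 x ∧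
    ∃ (N : Type u) (_ : CStarAlgebra N) (τ : TracialVNA N),
      (𝓜.restrict Y).Isomorphic (trivialBundle Y τ)

/-! ## Elementary estimates for the 2-norm -/

section TwoNorm

variable {A : Type*} [CStarAlgebra A] {φ : A →ₗ[ℂ] ℂ}

theorem twoNorm_sq (hφ : ∀ a, 0 ≤ φ (star a * a)) (a : A) :
    twoNorm φ a ^ 2 = (φ (star a * a)).re :=
  Real.sq_sqrt (Complex.le_def.mp (hφ a)).1

theorem twoNorm_sub_comm (a b : A) : twoNorm φ (a - b) = twoNorm φ (b - a) := by
  rw [← twoNorm_neg, neg_sub]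

theorem twoNorm_sub_le (hφ : ∀ a, 0 ≤ φ (star a * a)) (a b c : A) :
    twoNorm φ (a - c) ≤ twoNorm φ (a - b) + twoNorm φ (b - c) := by
  simpa using twoNorm_add_le φ hφ (a - b) (b - c)

theorem twoNorm_smul (c : ℂ) (a : A) : twoNorm φ (c • a) = ‖c‖ * twoNorm φ a := by
  have h : star (c • a) * (c • a) = ((‖c‖ ^ 2 : ℝ) : ℂ) • (star a * a) := by
    rw [star_smul, smul_mul_smul_comm, RCLike.star_def, Complex.conj_mul']
    push_cast; rfl
  rw [twoNorm, h, map_smul, smul_eq_mul, Complex.re_ofReal_mul, Real.sqrt_mul (sq_nonneg _),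
    Real.sqrt_sq (norm_nonneg c), twoNorm]

theorem twoNorm_sum_le (hφ : ∀ a, 0 ≤ φ (star a * a)) {ι : Type*} (s : Finset ι) (f : ι → A) :
    twoNorm φ (∑ i ∈ s, f i) ≤ ∑ i ∈ s, twoNorm φ (f i) :=
  Finset.le_sum_of_subadditive _ (twoNorm_zero φ).le (twoNorm_add_le φ hφ) s f

theorem twoNorm_parallelogram (hφ : ∀ a, 0 ≤ φ (star a * a)) (a b : A) :
    twoNorm φ (a + b) ^ 2 + twoNorm φ (a - b) ^ 2 = 2 * (twoNorm φ a ^ 2 + twoNorm φ b ^ 2) := by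
  simp only [twoNorm_sq hφ, star_add, star_sub, add_mul, mul_add, sub_mul, mul_sub, map_add,
    map_sub, Complex.add_re, Complex.sub_re]
  ring

end TwoNorm

namespace TracialVNA

variable {M : Type*} [CStarAlgebra M] (τ : TracialVNA M)

theorem twoNorm_one : twoNorm τ.tr 1 = 1 := by simp [twoNorm, τ.tr_one]

theorem eq_zero_of_twoNorm_eq_zero {a : M} (h : twoNorm τ.tr a = 0) : a = 0 :=
  τ.faithful a ((apply_star_mul_self_eq_zero_iff τ.tr τ.tr_nonneg a).mpr h)

theorem norm_tr_le (a : M) : ‖τ.tr a‖ ≤ twoNorm τ.tr a := by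
  simpa [τ.twoNorm_one] using norm_apply_star_mul_le τ.tr τ.tr_nonneg 1 a

theorem twoNorm_le_norm (a : M) : twoNorm τ.tr a ≤ ‖a‖ := by
  simpa [τ.twoNorm_one] using twoNorm_mul_le τ.tr τ.tr_nonneg a 1

theorem tendsto_tr {ι : Type*} {l : Filter ι} {u : ι → M} {a : M}
    (h : Tendsto (fun n => twoNorm τ.tr (u n - a)) l (𝓝 0)) :
    Tendsto (fun n => τ.tr (u n)) l (𝓝 (τ.tr a)) := by
  refine tendsto_iff_norm_sub_tendsto_zero.mpr (squeeze_zero (fun _ => norm_nonneg _) (fun n => ?_) h)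
  rw [← map_sub]
  exact τ.norm_tr_le _

/-- Completeness of the balls of arbitrary radius. -/
theorem exists_limit {C : ℝ} (u : ℕ → M) (hu : ∀ n, ‖u n‖ ≤ C)
    (hc : ∀ ε > 0, ∃ n₀, ∀ m ≥ n₀, ∀ n ≥ n₀, twoNorm τ.tr (u m - u n) < ε) :
    ∃ a, ‖a‖ ≤ C ∧ Tendsto (fun n => twoNorm τ.tr (u n - a)) atTop (𝓝 0) := by
  rcases (norm_nonneg _ |>.trans (hu 0)).eq_or_lt with rfl | hC
  · refine ⟨0, by simp, ?_⟩
    have : ∀ n, u n = 0 := fun n => norm_le_zero_iff.mp (hu n)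
    simp [this, twoNorm_zero]
  have hs : ∀ a b : M, (((C⁻¹ : ℝ) : ℂ) • a - ((C⁻¹ : ℝ) : ℂ) • b) = ((C⁻¹ : ℝ) : ℂ) • (a - b) :=
    fun a b => (smul_sub _ _ _).symm
  have hn : ‖((C⁻¹ : ℝ) : ℂ)‖ = C⁻¹ := by
    rw [Complex.norm_real, Real.norm_of_nonneg (by positivity)]
  obtain ⟨a, ha, ht⟩ := τ.complete (fun n => ((C⁻¹ : ℝ) : ℂ) • u n)
    (fun n => by
      rw [norm_smul, hn, inv_mul_le_iff₀ hC, mul_one]; exact hu n)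
    (fun ε hε => by
      obtain ⟨n₀, h⟩ := hc (C * ε) (by positivity)
      refine ⟨n₀, fun m hm n hn' => ?_⟩
      rw [hs, twoNorm_smul, hn, inv_mul_lt_iff₀ hC]
      exact h m hm n hn')
  refine ⟨(C : ℂ) • a, ?_, ?_⟩
  · rw [norm_smul, Complex.norm_real, Real.norm_of_nonneg hC.le]
    exact mul_le_of_le_one_right hC.le ha
  · have := ht.const_mul C
    rw [mul_zero] at this
    refine this.congr fun n => ?_
    have e : u n - (C : ℂ) • a = (C : ℂ) • (((C⁻¹ : ℝ) : ℂ) • u n - a) := by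
      rw [smul_sub, smul_smul, ← Complex.ofReal_mul, mul_inv_cancel₀ hC.ne', Complex.ofReal_one,
        one_smul]
    rw [e, twoNorm_smul, Complex.norm_real, Real.norm_of_nonneg hC.le]

/-! ## Normality of traces -/

section Order

variable [PartialOrder M] [StarOrderedRing M]

theorem tr_nonneg_of_nonneg {a : M} (ha : 0 ≤ a) : 0 ≤ τ.tr a := by
  obtain ⟨b, rfl⟩ := CStarAlgebra.nonneg_iff_eq_star_mul_self.mp ha
  exact τ.tr_nonneg b

theorem re_tr_nonneg {a : M} (ha : 0 ≤ a) : 0 ≤ (τ.tr a).re :=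
  (Complex.le_def.mp (τ.tr_nonneg_of_nonneg ha)).1

theorem re_tr_mono {a b : M} (h : a ≤ b) : (τ.tr a).re ≤ (τ.tr b).re := by
  have := τ.re_tr_nonneg (sub_nonneg.mpr h)
  rw [map_sub, Complex.sub_re] at this
  linarith

theorem ofReal_re_tr {a : M} (ha : 0 ≤ a) : (((τ.tr a).re : ℝ) : ℂ) = τ.tr a :=
  Complex.ext rfl (Complex.le_def.mp (τ.tr_nonneg_of_nonneg ha)).2

theorem eq_zero_of_re_tr_eq_zero {a : M} (ha : 0 ≤ a) (h : (τ.tr a).re = 0) : a = 0 := by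
  have h' : τ.tr a = 0 := by rw [← τ.ofReal_re_tr ha, h, Complex.ofReal_zero]
  obtain ⟨b, rfl⟩ := CStarAlgebra.nonneg_iff_eq_star_mul_self.mp ha
  rw [τ.faithful b h', mul_zero]

/-- Positivity passes to `‖·‖₂`-limits. -/
theorem nonneg_of_tendsto {ι : Type*} {l : Filter ι} [l.NeBot] {u : ι → M} {a : M}
    (hu : ∀ n, 0 ≤ u n) (h : Tendsto (fun n => twoNorm τ.tr (u n - a)) l (𝓝 0)) : 0 ≤ a := by
  have hsa : star a = a := by
    rw [← sub_eq_zero]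
    apply τ.eq_zero_of_twoNorm_eq_zero
    have h1 : ∀ n, twoNorm τ.tr (star a - a) ≤ twoNorm τ.tr (u n - a) + twoNorm τ.tr (u n - a) := by
      intro n
      refine (twoNorm_sub_le τ.tr_nonneg _ (u n) _).trans (add_le_add_left (le_of_eq ?_) _)
      rw [← twoNorm_star _ τ.tr_mul_comm, star_sub, star_star, (hu n).isSelfAdjoint.star_eq,
        twoNorm_sub_comm]
    refine le_antisymm ?_ (twoNorm_nonneg _ _)
    refine ge_of_tendsto' (by simpa using h.add h) h1
  have hsa' : IsSelfAdjoint a := hsa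
  set y := a⁻ with hy
  have hy0 : 0 ≤ y := CFC.negPart_nonneg a
  have hys : star y = y := hy0.isSelfAdjoint.star_eq
  have hyay : y * a * y = - (y * y * y) := by
    conv_lhs => rw [← CFC.posPart_sub_negPart a hsa']
    rw [mul_sub, CFC.negPart_mul_posPart, zero_sub, neg_mul]
  have hlim : Tendsto (fun n => τ.tr (y * u n * y)) l (𝓝 (τ.tr (y * a * y))) := by
    refine τ.tendsto_tr ?_
    have hb : ∀ n, twoNorm τ.tr (y * u n * y - y * a * y) ≤ ‖y‖ * twoNorm τ.tr (u n - a) * ‖y‖ := by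
      intro n
      rw [← sub_mul, ← mul_sub]
      refine (twoNorm_mul_le' τ.tr τ.tr_nonneg τ.tr_mul_comm _ _).trans ?_
      gcongr
      exact twoNorm_mul_le τ.tr τ.tr_nonneg _ _
    exact squeeze_zero (fun _ => twoNorm_nonneg _ _) hb (by simpa using (h.const_mul ‖y‖).mul_const ‖y‖)
  have hge : 0 ≤ (τ.tr (y * a * y)).re := by
    refine ge_of_tendsto' ((Complex.continuous_re.tendsto _).comp hlim) fun n => ?_
    refine τ.re_tr_nonneg ?_
    simpa [hys] using star_left_conjugate_nonneg (hu n) y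
  have hy3 : 0 ≤ y * y * y := by simpa [hys] using star_left_conjugate_nonneg hy0 y
  have hz : y * y * y = 0 := by
    refine τ.eq_zero_of_re_tr_eq_zero hy3 (le_antisymm ?_ (τ.re_tr_nonneg hy3))
    rw [hyay, map_neg, Complex.neg_re] at hge
    linarith
  have hy2 : y * y = 0 := by
    rw [← CStarRing.star_mul_self_eq_zero_iff, star_mul, hys, ← mul_assoc, hz, zero_mul]
  have hy1 : y = 0 := by rwa [← CStarRing.star_mul_self_eq_zero_iff, hys]
  exact (CFC.negPart_eq_zero_iff a hsa').mp hy1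

theorem exists_isLUB_of_monotone {c : ℕ → M} (hc : Monotone c) (h0 : ∀ n, 0 ≤ c n)
    (h1 : ∀ n, c n ≤ 1) :
    ∃ s, IsLUB (Set.range c) s ∧ Tendsto (fun n => twoNorm τ.tr (c n - s)) atTop (𝓝 0) := by
  have hbd : BddAbove (Set.range fun n => (τ.tr (c n)).re) :=
    ⟨(τ.tr 1).re, by rintro _ ⟨n, rfl⟩; exact τ.re_tr_mono (h1 n)⟩
  have hmono : Monotone fun n => (τ.tr (c n)).re := fun m n h => τ.re_tr_mono (hc h)
  have hcau := (tendsto_atTop_ciSup hmono hbd).cauchySeq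
  have key : ∀ m n, m ≤ n →
      twoNorm τ.tr (c n - c m) ^ 2 ≤ (τ.tr (c n)).re - (τ.tr (c m)).re := by
    intro m n hmn
    have hd : 0 ≤ c n - c m := sub_nonneg.mpr (hc hmn)
    have hd1 : c n - c m ≤ 1 := (sub_le_self _ (h0 m)).trans (h1 n)
    rw [twoNorm_sq τ.tr_nonneg, ← Complex.sub_re, ← map_sub, hd.isSelfAdjoint.star_eq]
    refine τ.re_tr_mono ?_
    simpa [sq] using CStarAlgebra.pow_antitone hd hd1 (by norm_num : 1 ≤ 2)
  obtain ⟨s, -, hs⟩ := τ.exists_limit (C := 1) c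
    (fun n => (CStarAlgebra.norm_le_one_iff_of_nonneg (c n) (h0 n)).mpr (h1 n)) (by
      intro ε hε
      obtain ⟨N, hN⟩ := Metric.cauchySeq_iff.mp hcau (ε ^ 2) (by positivity)
      refine ⟨N, fun m hm n hn => ?_⟩
      have hlt := hN m hm n hn
      rw [Real.dist_eq] at hlt
      refine lt_of_pow_lt_pow_left₀ 2 hε.le ?_
      rcases le_total m n with h | h
      · rw [twoNorm_sub_comm]
        refine (key m n h).trans_lt ((le_abs_self _).trans_lt ?_)
        rwa [abs_sub_comm]
      · exact (key n m h).trans_lt ((le_abs_self _).trans_lt hlt))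
  refine ⟨s, ⟨?_, fun b hb => ?_⟩, hs⟩
  · rintro _ ⟨m, rfl⟩
    refine sub_nonneg.mp (τ.nonneg_of_tendsto (u := fun n => c (n + m) - c m) (l := atTop)
      (fun n => sub_nonneg.mpr (hc (Nat.le_add_left m n))) ?_)
    simpa using (tendsto_add_atTop_iff_nat m).mpr hs
  · refine sub_nonneg.mp (τ.nonneg_of_tendsto (u := fun n => b - c n) (l := atTop)
      (fun n => sub_nonneg.mpr (hb ⟨n, rfl⟩)) ?_)
    refine hs.congr fun n => ?_
    rw [sub_sub_sub_cancel_left, twoNorm_sub_comm]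

theorem tendsto_tr_of_isLUB {c : ℕ → M} (hc : Monotone c) (h0 : ∀ n, 0 ≤ c n)
    (h1 : ∀ n, c n ≤ 1) {s : M} (hs : IsLUB (Set.range c) s) :
    Tendsto (fun n => (τ.tr (c n)).re) atTop (𝓝 (τ.tr s).re) := by
  obtain ⟨s', hs', ht⟩ := τ.exists_isLUB_of_monotone hc h0 h1
  rw [hs.unique hs']
  exact (Complex.continuous_re.tendsto _).comp (τ.tendsto_tr ht)

theorem tendsto_tr_of_isGLB {c : ℕ → M} (hc : Antitone c) (h0 : ∀ n, 0 ≤ c n)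
    (h1 : ∀ n, c n ≤ 1) {s : M} (hs : IsGLB (Set.range c) s) :
    Tendsto (fun n => (τ.tr (c n)).re) atTop (𝓝 (τ.tr s).re) := by
  have h : IsLUB (Set.range fun n => 1 - c n) (1 - s) := by
    constructor
    · rintro _ ⟨n, rfl⟩
      exact sub_le_sub_left (hs.1 ⟨n, rfl⟩) 1
    · intro b hb
      rw [sub_le_comm]
      refine hs.2 ?_
      rintro _ ⟨n, rfl⟩
      rw [sub_le_comm]
      exact hb ⟨n, rfl⟩
  have := τ.tendsto_tr_of_isLUB (fun m n hmn => sub_le_sub_left (hc hmn) 1)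
    (fun n => sub_nonneg.mpr (h1 n)) (fun n => sub_le_self 1 (h0 n)) h
  simpa [τ.tr_one] using this.const_sub 1

theorem exists_isGLB_of_antitone (τ : TracialVNA M) {c : ℕ → M} (hc : Antitone c) (h0 : ∀ n, 0 ≤ c n)
    (h1 : ∀ n, c n ≤ 1) : ∃ s, IsGLB (Set.range c) s := by
  obtain ⟨s, hs, -⟩ := τ.exists_isLUB_of_monotone (c := fun n => 1 - c n)
    (fun m n hmn => sub_le_sub_left (hc hmn) 1)
    (fun n => sub_nonneg.mpr (h1 n)) (fun n => sub_le_self 1 (h0 n))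
  refine ⟨1 - s, ?_, fun b hb => ?_⟩
  · rintro _ ⟨n, rfl⟩
    rw [sub_le_comm]
    exact hs.1 ⟨n, rfl⟩
  · rw [le_sub_comm]
    refine hs.2 ?_
    rintro _ ⟨n, rfl⟩
    exact sub_le_sub_left (hb ⟨n, rfl⟩) 1

end Order

end TracialVNA

section ResolventCutoff

variable {A : Type*} [CStarAlgebra A]

/-- The operator monotone cut-off `a ↦ 1 - (1 + a)⁻¹`. -/
noncomputable def cutoff (a : A) : A := cfc (fun x : ℝ => 1 - (1 + x)⁻¹) a

variable [PartialOrder A] [StarOrderedRing A]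

theorem continuousOn_cutoff_fun {a : A} (ha : 0 ≤ a) :
    ContinuousOn (fun x : ℝ => 1 - (1 + x)⁻¹) (spectrum ℝ a) := by
  refine continuousOn_const.sub ((continuousOn_const.add continuousOn_id).inv₀ fun x hx => ?_)
  have := spectrum_nonneg_of_nonneg ha hx
  change 1 + x ≠ 0
  positivity

theorem cutoff_mono {a b : A} (ha : 0 ≤ a) (hab : a ≤ b) : cutoff a ≤ cutoff b := by
  have hb := ha.trans hab
  have h := CFC.monotoneOn_one_sub_one_add_inv_real (A := A) ha hb hab
  have key : ∀ {x : A}, 0 ≤ x → cfcₙ (fun x : ℝ => 1 - (1 + x)⁻¹) x = cutoff x := by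
    intro x hx
    refine cfcₙ_eq_cfc (hf := ?_)
    refine continuousOn_const.sub ((continuousOn_const.add continuousOn_id).inv₀ fun y hy => ?_)
    have := quasispectrum_nonneg_of_nonneg x hx y hy
    change 1 + y ≠ 0
    positivity
  rwa [key ha, key hb] at h

theorem cutoff_nonneg {a : A} (ha : 0 ≤ a) : 0 ≤ cutoff a := by
  refine cfc_nonneg fun x hx => ?_
  have h0 : 0 ≤ x := spectrum_nonneg_of_nonneg ha hx
  have : (1 + x)⁻¹ ≤ 1 := inv_le_one_of_one_le₀ (by linarith)
  linarith

theorem cutoff_le_one {a : A} (ha : 0 ≤ a) : cutoff a ≤ 1 := by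
  refine cfc_le_one _ _ fun x hx => ?_
  have h0 : 0 ≤ x := spectrum_nonneg_of_nonneg ha hx
  have : 0 ≤ (1 + x)⁻¹ := by positivity
  linarith

theorem cutoff_le_self {a : A} (ha : 0 ≤ a) : cutoff a ≤ a := by
  conv_rhs => rw [← cfc_id' ℝ a]
  refine cfc_mono (fun x hx => ?_) (continuousOn_cutoff_fun ha)
  have h0 : 0 ≤ x := spectrum_nonneg_of_nonneg ha hx
  have h1 : 0 < 1 + x := by linarith
  have h2 : (1 + x)⁻¹ * (1 + x) = 1 := inv_mul_cancel₀ h1.ne'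
  nlinarith [inv_pos.mpr h1]

theorem self_le_two_smul_cutoff {a : A} (ha : 0 ≤ a) (ha1 : a ≤ 1) :
    a ≤ (2 : ℝ) • cutoff a := by
  conv_lhs => rw [← cfc_id' ℝ a]
  rw [cutoff, ← cfc_smul _ _ _ (continuousOn_cutoff_fun ha)]
  refine cfc_mono (fun x hx => ?_) (by fun_prop)
    ((continuousOn_cutoff_fun ha).const_smul (2 : ℝ))
  have h0 : 0 ≤ x := spectrum_nonneg_of_nonneg ha hx
  have h1 : x ≤ 1 := (CFC.le_one_iff a).mp ha1 x hx
  have h2 : (1 + x)⁻¹ * (1 + x) = 1 := inv_mul_cancel₀ (by linarith)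
  have h3 : 0 < (1 + x)⁻¹ := by positivity
  simp only [smul_eq_mul]
  nlinarith

end ResolventCutoff

namespace TracialVNA

variable {M : Type*} [CStarAlgebra M] (τ τ' : TracialVNA M)

section Order

variable [PartialOrder M] [StarOrderedRing M]

/-- A tracial state on a tracial von Neumann algebra with respect to which the unit ball is complete
is absolutely continuous, on the positive part of the unit ball, with respect to any other. -/
theorem exists_delta_of_nonneg {ε : ℝ} (hε : 0 < ε) :
    ∃ δ > 0, ∀ b : M, 0 ≤ b → b ≤ 1 → (τ.tr b).re < δ → (τ'.tr b).re < ε := by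
  by_contra! hcon
  choose b hb0 hb1 hbτ hbτ' using fun n : ℕ => hcon ((1 / 2) ^ n) (by positivity)
  let S : ℕ → ℕ → M := fun n m => ∑ k ∈ Finset.Ico n m, b k
  have hS0 : ∀ n m, 0 ≤ S n m := fun n m => Finset.sum_nonneg fun k _ => hb0 k
  let c : ℕ → ℕ → M := fun n m => cutoff (S n m)
  have hc0 : ∀ n m, 0 ≤ c n m := fun n m => cutoff_nonneg (hS0 n m)
  have hc1 : ∀ n m, c n m ≤ 1 := fun n m => cutoff_le_one (hS0 n m)
  have hmono : ∀ n, Monotone (c n) := fun n m m' h => cutoff_mono (hS0 n m)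
    (Finset.sum_le_sum_of_subset_of_nonneg (Finset.Ico_subset_Ico_right h) fun k _ _ => hb0 k)
  have hanti : ∀ m, Antitone (c · m) := fun m n n' h => cutoff_mono (hS0 n' m)
    (Finset.sum_le_sum_of_subset_of_nonneg (Finset.Ico_subset_Ico_left h) fun k _ _ => hb0 k)
  choose s hs hst using fun n => τ.exists_isLUB_of_monotone (hmono n) (hc0 n) (hc1 n)
  have hs0 : ∀ n, 0 ≤ s n := fun n => (hc0 n 0).trans ((hs n).1 ⟨0, rfl⟩)
  have hs1 : ∀ n, s n ≤ 1 := fun n => (hs n).2 (by rintro _ ⟨m, rfl⟩; exact hc1 n m)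
  have hsanti : Antitone s := fun n n' h => (hs n').2 (by
    rintro _ ⟨m, rfl⟩
    exact (hanti m h).trans ((hs n).1 ⟨m, rfl⟩))
  have hsτ : ∀ n, (τ.tr (s n)).re ≤ 2 * (1 / 2) ^ n := by
    intro n
    refine le_of_tendsto' (τ.tendsto_tr_of_isLUB (hmono n) (hc0 n) (hc1 n) (hs n)) fun m => ?_
    refine (τ.re_tr_mono (cutoff_le_self (hS0 n m))).trans ?_
    simp only [S, map_sum, Complex.re_sum]
    refine (Finset.sum_le_sum fun k _ => (hbτ k).le).trans ?_
    rcases le_total n m with h | h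
    · rw [geom_sum_Ico (by norm_num) h]
      have : (0 : ℝ) ≤ (1 / 2) ^ m := by positivity
      rw [div_le_iff_of_neg (by norm_num)]
      linarith
    · rw [Finset.Ico_eq_empty_of_le h, Finset.sum_empty]
      positivity
  have hsτ' : ∀ n, ε / 2 ≤ (τ'.tr (s n)).re := by
    intro n
    have h1 : cutoff (b n) ≤ s n := by
      refine le_trans (le_of_eq ?_) ((hs n).1 ⟨n + 1, rfl⟩)
      simp [c, S]
    have h2 := τ'.re_tr_mono (self_le_two_smul_cutoff (hb0 n) (hb1 n))
    rw [LinearMap.map_smul_of_tower, Complex.real_smul, Complex.re_ofReal_mul] at h2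
    have h3 := τ'.re_tr_mono h1
    have h4 := hbτ' n
    linarith
  obtain ⟨g, hg⟩ := τ.exists_isGLB_of_antitone hsanti hs0 hs1
  have hg0 : 0 ≤ g := hg.2 (by rintro _ ⟨n, rfl⟩; exact hs0 n)
  have hgτ : (τ.tr g).re = 0 := by
    refine tendsto_nhds_unique (τ.tendsto_tr_of_isGLB hsanti hs0 hs1 hg) ?_
    refine squeeze_zero (fun n => τ.re_tr_nonneg (hs0 n)) hsτ ?_
    simpa using (tendsto_pow_atTop_nhds_zero_of_lt_one (r := (1 / 2 : ℝ))
      (by norm_num) (by norm_num)).const_mul 2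
  have hgz : g = 0 := τ.eq_zero_of_re_tr_eq_zero hg0 hgτ
  have hgτ' : ε / 2 ≤ (τ'.tr g).re :=
    ge_of_tendsto' (τ'.tendsto_tr_of_isGLB hsanti hs0 hs1 hg) hsτ'
  rw [hgz, map_zero, Complex.zero_re] at hgτ'
  linarith

end Order

theorem exists_delta {ε : ℝ} (hε : 0 < ε) {C : ℝ} (hC : 0 < C) :
    ∃ δ > 0, ∀ u : M, ‖u‖ ≤ C → twoNorm τ.tr u < δ → ‖τ'.tr u‖ < ε := by
  let _ := CStarAlgebra.spectralOrder M
  let _ := CStarAlgebra.spectralOrderedRing M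
  obtain ⟨δ, hδ, h⟩ := τ.exists_delta_of_nonneg τ' (ε := (ε / C) ^ 2) (by positivity)
  refine ⟨C * √δ, by positivity, fun u hu hlt => (τ'.norm_tr_le u).trans_lt ?_⟩
  set v : M := ((C⁻¹ : ℝ) : ℂ) • u with hv
  have hn : ‖((C⁻¹ : ℝ) : ℂ)‖ = C⁻¹ := by
    rw [Complex.norm_real, Real.norm_of_nonneg (by positivity)]
  have hv1 : ‖star v * v‖ ≤ 1 := by
    rw [CStarRing.norm_star_mul_self, hv, norm_smul, hn]
    have : C⁻¹ * ‖u‖ ≤ 1 := by rwa [inv_mul_le_iff₀ hC, mul_one]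
    exact mul_le_one₀ this (by positivity) this
  have h1 := h (star v * v) (star_mul_self_nonneg v)
    ((CStarAlgebra.norm_le_one_iff_of_nonneg _ (star_mul_self_nonneg v)).mp hv1) (by
      rw [← twoNorm_sq τ.tr_nonneg, hv, twoNorm_smul, hn, ← Real.sq_sqrt hδ.le]
      refine pow_lt_pow_left₀ ?_ (mul_nonneg (by positivity) (twoNorm_nonneg _ _)) two_ne_zero
      rwa [inv_mul_lt_iff₀ hC])
  rw [← twoNorm_sq τ'.tr_nonneg, hv, twoNorm_smul, hn] at h1
  have h2 := lt_of_pow_lt_pow_left₀ 2 (by positivity) h1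
  rw [div_eq_inv_mul] at h2
  exact lt_of_mul_lt_mul_left h2 (by positivity)

/-! ## Averaging over the unitary group and uniqueness of the trace -/

/-- The convex hull of the unitary orbit of `a`. -/
def unitaryHull (a : M) : Set M :=
  convexHull ℝ (Set.range fun u : unitary M => (u : M) * a * star (u : M))

theorem mem_unitaryHull (a : M) : a ∈ unitaryHull a :=
  subset_convexHull _ _ ⟨1, by simp⟩

theorem conj_mem_unitaryHull {a b : M} (hb : b ∈ unitaryHull a) (u : unitary M) :
    (u : M) * b * star (u : M) ∈ unitaryHull a := by
  have himg := (LinearMap.mulLeftRight ℝ ((u : M), star (u : M))).image_convexHull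
    (Set.range fun u : unitary M => (u : M) * a * star (u : M))
  have h : LinearMap.mulLeftRight ℝ ((u : M), star (u : M)) b ∈ unitaryHull a := by
    have := Set.mem_image_of_mem (LinearMap.mulLeftRight ℝ ((u : M), star (u : M))) hb
    rw [unitaryHull, himg] at this
    refine convexHull_mono ?_ this
    rintro _ ⟨_, ⟨v, rfl⟩, rfl⟩
    exact ⟨u * v, by simp [mul_assoc]⟩
  simpa using h

theorem tr_eq_of_mem_unitaryHull {a b : M} (hb : b ∈ unitaryHull a) : τ.tr b = τ.tr a := by
  have hconv : Convex ℝ {b : M | τ.tr b = τ.tr a} := by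
    intro x hx y hy s t _ _ hst
    simp only [Set.mem_ofPred_eq] at hx hy ⊢
    rw [map_add, LinearMap.map_smul_of_tower, LinearMap.map_smul_of_tower, hx, hy, ← add_smul, hst,
      one_smul]
  refine convexHull_min ?_ hconv hb
  rintro _ ⟨u, rfl⟩
  simp only [Set.mem_ofPred_eq]
  rw [τ.tr_mul_comm, ← mul_assoc, Unitary.coe_star_mul_self, one_mul]

theorem norm_le_of_mem_unitaryHull {a b : M} (hb : b ∈ unitaryHull a) : ‖b‖ ≤ ‖a‖ := by
  have : b ∈ Metric.closedBall (0 : M) ‖a‖ := by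
    refine convexHull_min ?_ (convex_closedBall _ _) hb
    rintro _ ⟨u, rfl⟩
    simp only [mem_closedBall_zero_iff]
    rw [← Unitary.coe_star, CStarRing.norm_mul_coe_unitary, CStarRing.norm_coe_unitary_mul]
  simpa using this

theorem twoNorm_unitary_conj (u : unitary M) (a : M) :
    twoNorm τ.tr ((u : M) * a * star (u : M)) = twoNorm τ.tr a := by
  have : star ((u : M) * a * star (u : M)) * ((u : M) * a * star (u : M)) =
      (u : M) * (star a * a) * star (u : M) := by
    simp only [star_mul, star_star, mul_assoc]
    rw [← mul_assoc (star (u : M)) (u : M), Unitary.coe_star_mul_self, one_mul]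
  rw [twoNorm, this, τ.tr_mul_comm, ← mul_assoc, Unitary.coe_star_mul_self, one_mul, twoNorm]

/-- Dixmier averaging in the 2-norm. -/
theorem exists_central_limit (a : M) : ∃ (c : ℕ → M) (z : M), (∀ n, c n ∈ unitaryHull a) ∧
    Tendsto (fun n => twoNorm τ.tr (c n - z)) atTop (𝓝 0) ∧ ∀ b, z * b = b * z := by
  set d := sInf (twoNorm τ.tr '' unitaryHull a) with hd
  have hbdd : BddBelow (twoNorm τ.tr '' unitaryHull a) :=
    ⟨0, by rintro _ ⟨b, -, rfl⟩; exact twoNorm_nonneg _ _⟩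
  have hne : (twoNorm τ.tr '' unitaryHull a).Nonempty := ⟨_, _, mem_unitaryHull a, rfl⟩
  have hd0 : 0 ≤ d := le_csInf hne (by rintro _ ⟨b, -, rfl⟩; exact twoNorm_nonneg _ _)
  have hdle : ∀ b ∈ unitaryHull a, d ≤ twoNorm τ.tr b := fun b hb => csInf_le hbdd ⟨b, hb, rfl⟩
  have hmid : ∀ b ∈ unitaryHull a, ∀ c ∈ unitaryHull a,
      twoNorm τ.tr (b - c) ^ 2 ≤ 2 * (twoNorm τ.tr b ^ 2 + twoNorm τ.tr c ^ 2) - 4 * d ^ 2 := by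
    intro b hb c hc
    have hm : ((1 / 2 : ℝ) • b + (1 / 2 : ℝ) • c) ∈ unitaryHull a :=
      convex_convexHull ℝ _ hb hc (by norm_num) (by norm_num) (by norm_num)
    have h1 := hdle _ hm
    rw [← smul_add, ← Complex.coe_smul, twoNorm_smul, Complex.norm_real] at h1
    norm_num at h1
    have h2 := twoNorm_parallelogram τ.tr_nonneg b c
    nlinarith [twoNorm_nonneg τ.tr (b + c)]
  have hex : ∀ n : ℕ, ∃ b ∈ unitaryHull a, twoNorm τ.tr b < d + 1 / ((n : ℝ) + 1) := by
    intro n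
    obtain ⟨_, ⟨b, hb, rfl⟩, hlt⟩ := exists_lt_of_csInf_lt hne
      (show d < d + 1 / ((n : ℝ) + 1) by have : (0:ℝ) < 1 / ((n : ℝ) + 1) := by positivity
                                         linarith)
    exact ⟨b, hb, hlt⟩
  choose c hc hcd using hex
  have hclim : Tendsto (fun n => twoNorm τ.tr (c n)) atTop (𝓝 d) := by
    refine tendsto_of_tendsto_of_tendsto_of_le_of_le tendsto_const_nhds
      (by simpa using tendsto_one_div_add_atTop_nhds_zero_nat.const_add d)
      (fun n => hdle _ (hc n)) (fun n => (hcd n).le)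
  have hsq := hclim.pow 2
  obtain ⟨z, -, hz⟩ := τ.exists_limit c (fun n => norm_le_of_mem_unitaryHull (hc n)) (by
    intro ε hε
    have hev := hsq.eventually_lt_const (show d ^ 2 < d ^ 2 + ε ^ 2 / 4 by
      have : 0 < ε ^ 2 := by positivity
      linarith)
    obtain ⟨N, hN⟩ := eventually_atTop.mp hev
    refine ⟨N, fun m hm n hn => lt_of_pow_lt_pow_left₀ 2 hε.le ?_⟩
    have := hmid _ (hc m) _ (hc n)
    have h1 := hN m hm
    have h2 := hN n hn
    linarith)
  refine ⟨c, z, hc, hz, ?_⟩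
  have hfix : ∀ u : unitary M, (u : M) * z * star (u : M) = z := by
    intro u
    rw [← sub_eq_zero]
    apply τ.eq_zero_of_twoNorm_eq_zero
    refine le_antisymm ?_ (twoNorm_nonneg _ _)
    have hsq0 : Tendsto (fun n => twoNorm τ.tr ((u : M) * c n * star (u : M) - c n))
        atTop (𝓝 0) := by
      have hlim : Tendsto (fun n => √(4 * twoNorm τ.tr (c n) ^ 2 - 4 * d ^ 2)) atTop (𝓝 0) := by
        have := ((hsq.const_mul 4).sub_const (4 * d ^ 2)).sqrt
        simpa using this
      refine squeeze_zero (fun _ => twoNorm_nonneg _ _) (fun n => ?_) hlim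
      refine Real.le_sqrt_of_sq_le ?_
      have := hmid _ (conj_mem_unitaryHull (hc n) u) _ (hc n)
      rw [twoNorm_unitary_conj] at this
      linarith
    refine ge_of_tendsto' (f := fun n => twoNorm τ.tr (c n - z) +
      twoNorm τ.tr ((u : M) * c n * star (u : M) - c n) + twoNorm τ.tr (c n - z))
      (b := twoNorm τ.tr ((u : M) * z * star (u : M) - z)) (a := 0) (x := atTop)
      (by simpa using (hz.add hsq0).add hz) fun n => ?_
    refine (twoNorm_sub_le τ.tr_nonneg _ (c n) _).trans (add_le_add_left ?_ _)
    refine (twoNorm_sub_le τ.tr_nonneg _ ((u : M) * c n * star (u : M)) _).trans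
      (add_le_add_left (le_of_eq ?_) _)
    rw [← sub_mul, ← mul_sub, twoNorm_unitary_conj, twoNorm_sub_comm]
  intro b
  have hb : b ∈ Submodule.span ℂ (unitary M : Set M) := by
    rw [CStarAlgebra.span_unitary]; trivial
  induction hb using Submodule.span_induction with
  | mem u hu =>
    have := hfix ⟨u, hu⟩
    simp only at this
    calc z * u = (u * z * star u) * u := by rw [this]
      _ = u * z := by rw [mul_assoc, Unitary.star_mul_self_of_mem hu, mul_one]
  | zero => simp
  | add x y _ _ hx hy => rw [mul_add, add_mul, hx, hy]
  | smul r x _ hx => rw [mul_smul_comm, smul_mul_assoc, hx]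

variable {τ}

/-- Uniqueness of the trace on a II₁ factor. -/
theorem IsII1Factor.tr_unique (hM : τ.IsII1Factor) : τ'.tr = τ.tr := by
  ext a
  obtain ⟨c, z, hc, hz, hcomm⟩ := τ.exists_central_limit a
  obtain ⟨l, rfl⟩ := hM.factor z hcomm
  have hl : ∀ σ : TracialVNA M, σ.tr (algebraMap ℂ M l) = l := by
    intro σ
    rw [Algebra.algebraMap_eq_smul_one, map_smul, σ.tr_one, smul_eq_mul, mul_one]
  have h1 : τ.tr a = l := by
    refine tendsto_nhds_unique (f := fun n => τ.tr (c n)) (l := atTop) ?_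
      ((hl τ) ▸ τ.tendsto_tr hz)
    simp only [τ.tr_eq_of_mem_unitaryHull (hc _)]
    exact tendsto_const_nhds
  have h2 : τ'.tr a = l := by
    rw [← sub_eq_zero, ← norm_le_zero_iff]
    refine le_of_forall_pos_lt_add fun ε hε => ?_
    obtain ⟨δ, hδ, h⟩ := τ.exists_delta τ' hε (C := ‖a‖ + ‖algebraMap ℂ M l‖ + 1) (by positivity)
    obtain ⟨n, hn⟩ := (hz.eventually_lt_const hδ).exists
    have := h (c n - algebraMap ℂ M l) (by
      refine (norm_sub_le _ _).trans ?_
      linarith [norm_le_of_mem_unitaryHull (hc n)]) hn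
    rw [map_sub, τ'.tr_eq_of_mem_unitaryHull (hc n), hl] at this
    linarith
  rw [h1, h2]

end TracialVNA

/-! ## Vector functionals in the GNS representation -/

namespace PositiveLinearMap

variable {A : Type*} [CStarAlgebra A] [PartialOrder A] [StarOrderedRing A] (f : A →ₚ[ℂ] ℂ)

/-- The GNS representation as a continuous linear map. -/
noncomputable def gnsCLM : A →L[ℂ] (f.GNS →L[ℂ] f.GNS) where
  toFun a := f.gnsStarAlgHom a
  map_add' := map_add _
  map_smul' c a := map_smul f.gnsStarAlgHom c a
  cont := map_continuous f.gnsStarAlgHom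

/-- The vector functional `a ↦ ⟪η, π(a) ξ⟫`. -/
noncomputable def vectorFunctional (η ξ : f.GNS) : StrongDual ℂ A :=
  (innerSL ℂ η).comp ((ContinuousLinearMap.apply ℂ f.GNS ξ).comp f.gnsCLM)

theorem vectorFunctional_apply (η ξ : f.GNS) (a : A) :
    f.vectorFunctional η ξ a = ⟪η, f.gnsStarAlgHom a ξ⟫_ℂ := rfl

theorem vectorFunctional_coe (y z a : A) :
    f.vectorFunctional (f.toPreGNS y : f.GNS) (f.toPreGNS z : f.GNS) a = f (star y * (a * z)) := by
  change ⟪(f.toPreGNS y : f.GNS), f.gnsNonUnitalStarAlgHom a (f.toPreGNS z : f.GNS)⟫_ℂ = _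
  rw [gnsNonUnitalStarAlgHom_apply_coe, UniformSpace.Completion.inner_coe, preGNS_inner_def]
  rfl

theorem norm_vectorFunctional_le (η ξ : f.GNS) : ‖f.vectorFunctional η ξ‖ ≤ ‖η‖ * ‖ξ‖ := by
  refine ContinuousLinearMap.opNorm_le_bound _ (by positivity) fun a => ?_
  rw [vectorFunctional_apply]
  refine (norm_inner_le_norm _ _).trans ?_
  rw [mul_assoc, mul_comm ‖ξ‖]
  gcongr
  refine (ContinuousLinearMap.le_opNorm _ _).trans ?_
  gcongr
  exact NonUnitalStarAlgHom.norm_apply_le f.gnsStarAlgHom a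

theorem continuous_vectorFunctional :
    Continuous fun p : f.GNS × f.GNS => f.vectorFunctional p.1 p.2 := by
  unfold vectorFunctional
  exact ((innerSL ℂ).continuous.comp continuous_fst).clm_comp
    ((((ContinuousLinearMap.apply ℂ f.GNS).continuous.comp continuous_snd)).clm_comp
      continuous_const)

/-- A closed set of functionals that is stable under addition and contains the functionals
`f (y* · z)` contains all normal functionals of the GNS representation of `f`. -/
theorem mem_of_hasSum_inner {S : Set (StrongDual ℂ A)} (hS : IsClosed S) (h0 : 0 ∈ S)
    (hadd : ∀ φ ∈ S, ∀ ψ ∈ S, φ + ψ ∈ S)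
    (hmem : ∀ y z, f.vectorFunctional (f.toPreGNS y : f.GNS) (f.toPreGNS z : f.GNS) ∈ S)
    {ξ η : ℕ → f.GNS} (hξ : Summable fun n => ‖ξ n‖ ^ 2) (hη : Summable fun n => ‖η n‖ ^ 2)
    {φ : StrongDual ℂ A} (hφ : ∀ a, HasSum (fun n => ⟪η n, f.gnsStarAlgHom a (ξ n)⟫_ℂ) (φ a)) :
    φ ∈ S := by
  have hvec : ∀ η ξ : f.GNS, f.vectorFunctional η ξ ∈ S := fun η ξ => by
    induction η, ξ using UniformSpace.Completion.induction_on₂ with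
    | hp => exact hS.preimage f.continuous_vectorFunctional
    | ih y z => exact hmem y z
  have hsum : Summable fun n => f.vectorFunctional (η n) (ξ n) := by
    refine Summable.of_norm_bounded (g := fun n => ‖η n‖ ^ 2 + ‖ξ n‖ ^ 2) (hη.add hξ) fun n => ?_
    refine (f.norm_vectorFunctional_le _ _).trans ?_
    nlinarith [sq_nonneg (‖η n‖ - ‖ξ n‖), sq_nonneg ‖η n‖, sq_nonneg ‖ξ n‖]
  have hlim := hsum.hasSum
  have heq : ∑' n, f.vectorFunctional (η n) (ξ n) = φ := by
    ext a
    refine HasSum.unique ?_ (hφ a)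
    exact hlim.mapL (ContinuousLinearMap.apply ℂ ℂ a)
  rw [heq] at hlim
  refine hS.mem_of_tendsto hlim (Eventually.of_forall fun s => ?_)
  induction s using Finset.cons_induction with
  | empty => simpa using h0
  | cons n s hn ih =>
    rw [Finset.sum_cons]
    exact hadd _ (hvec _ _) _ ih

end PositiveLinearMap

namespace TracialVNA

variable {M : Type*} [CStarAlgebra M] (τ : TracialVNA M)

/-- The trace transported along a *-isomorphism. -/
noncomputable def comap {N : Type*} [CStarAlgebra N] (τ : TracialVNA N) (e : M ≃⋆ₐ[ℂ] N) : TracialVNA M where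
  tr := τ.tr ∘ₗ (e : M →ₐ[ℂ] N).toLinearMap
  tr_one := by simp [τ.tr_one]
  tr_nonneg a := by simpa [map_star] using τ.tr_nonneg (e a)
  tr_mul_comm a b := by simpa using τ.tr_mul_comm (e a) (e b)
  faithful a h := by
    have := τ.faithful (e a) (by simpa [map_star] using h)
    simpa using this
  complete u hu hc := by
    have hn : ∀ a, ‖e a‖ = ‖a‖ := StarAlgEquiv.norm_map e
    have h2 : ∀ a, twoNorm (τ.tr ∘ₗ (e : M →ₐ[ℂ] N).toLinearMap) a = twoNorm τ.tr (e a) :=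
      fun a => by simp [twoNorm, map_star]
    obtain ⟨b, hb, ht⟩ := τ.complete (fun n => e (u n)) (fun n => by rw [hn]; exact hu n)
      (by simpa only [h2, map_sub] using hc)
    refine ⟨e.symm b, ?_, ?_⟩
    · rwa [← hn, StarAlgEquiv.apply_symm_apply]
    · simpa only [h2, map_sub, StarAlgEquiv.apply_symm_apply] using ht

theorem comap_tr {N : Type*} [CStarAlgebra N] (τ : TracialVNA N) (e : M ≃⋆ₐ[ℂ] N) (a : M) :
    (τ.comap e).tr a = τ.tr (e a) := rfl

variable {τ} in
theorem IsII1Factor.tr_apply (hM : τ.IsII1Factor) (α : M ≃⋆ₐ[ℂ] M) (a : M) :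
    τ.tr (α a) = τ.tr a := by
  rw [← comap_tr, hM.tr_unique]

variable {τ} in
theorem IsII1Factor.twoNorm_apply (hM : τ.IsII1Factor) (α : M ≃⋆ₐ[ℂ] M) (a : M) :
    twoNorm τ.tr (α a) = twoNorm τ.tr a := by
  rw [twoNorm, ← map_star, ← map_mul, hM.tr_apply, twoNorm]

/-! ## The `u`-topology and pointwise 2-norm convergence -/

theorem precomp_apply (φ : StrongDual ℂ M) (α : M ≃⋆ₐ[ℂ] M) (a : M) :
    precomp φ α a = φ (α a) := rfl

theorem norm_precomp_sub_le (φ ψ : StrongDual ℂ M) (α : M ≃⋆ₐ[ℂ] M) :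
    ‖precomp φ α - precomp ψ α‖ ≤ ‖φ - ψ‖ := by
  refine ContinuousLinearMap.opNorm_le_bound _ (norm_nonneg _) fun a => ?_
  rw [← StarAlgEquiv.norm_map α a]
  exact (φ - ψ).le_opNorm (α a)

theorem exists_mem_predual (y : M) : ∃ φ ∈ τ.predual, ∀ a, φ a = τ.tr (star y * a) := by
  let _ := CStarAlgebra.spectralOrder M
  let _ := CStarAlgebra.spectralOrderedRing M
  let f := τ.positiveTrace
  have hz : ∀ v : f.GNS, Summable fun n => ‖(Pi.single 0 v : ℕ → f.GNS) n‖ ^ 2 := fun v =>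
    summable_of_ne_finset_zero (s := {0}) fun n hn => by
      rw [Pi.single_eq_of_ne (by simpa using hn), norm_zero, zero_pow two_ne_zero]
  refine ⟨f.vectorFunctional (f.toPreGNS y : f.GNS) (f.toPreGNS 1 : f.GNS),
    ⟨Pi.single 0 (f.toPreGNS 1 : f.GNS), Pi.single 0 (f.toPreGNS y : f.GNS), hz _, hz _,
      fun a => ?_⟩, fun a => ?_⟩
  · convert hasSum_single (f := fun n => ⟪(Pi.single 0 (f.toPreGNS y : f.GNS) : ℕ → f.GNS) n,
      f.gnsStarAlgHom a ((Pi.single 0 (f.toPreGNS 1 : f.GNS) : ℕ → f.GNS) n)⟫_ℂ) 0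
      (fun n hn => by rw [Pi.single_eq_of_ne hn, inner_zero_left]) using 1
    rw [Pi.single_eq_same, Pi.single_eq_same, PositiveLinearMap.vectorFunctional_apply]
  · rw [PositiveLinearMap.vectorFunctional_coe, mul_one]
    rfl

variable {τ} {ι : Type*} {l : Filter ι} {g : ι → M ≃⋆ₐ[ℂ] M} {β : M ≃⋆ₐ[ℂ] M}

theorem tendsto_uTopology_iff :
    Tendsto g l (@nhds _ τ.uTopology β) ↔
      ∀ φ ∈ τ.predual, Tendsto (fun i => precomp φ (g i)) l (𝓝 (precomp φ β)) := by
  simp only [nhds_iInf, nhds_induced, tendsto_iInf, tendsto_comap_iff]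
  rfl

theorem IsII1Factor.tendsto_twoNorm_of_tendsto (hM : τ.IsII1Factor)
    (h : Tendsto g l (@nhds _ τ.uTopology β)) (m : M) :
    Tendsto (fun i => twoNorm τ.tr (g i m - β m)) l (𝓝 0) := by
  obtain ⟨φ, hφ, hφa⟩ := τ.exists_mem_predual (β m)
  have h1 := tendsto_uTopology_iff.mp h φ hφ
  have h2 : Tendsto (fun i => φ (g i m)) l (𝓝 (φ (β m))) :=
    ((ContinuousLinearMap.apply ℂ ℂ m).continuous.tendsto _).comp h1
  have key : ∀ i, twoNorm τ.tr (g i m - β m) ^ 2 = 2 * (φ (β m)).re - 2 * (φ (g i m)).re := by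
    intro i
    have hn : (φ (β m)).re = twoNorm τ.tr m ^ 2 := by
      rw [hφa, ← twoNorm_sq τ.tr_nonneg, hM.twoNorm_apply]
    have hc : (τ.tr (star (g i m) * β m)).re = (τ.tr (star (β m) * g i m)).re := by
      have h3 : τ.tr (star (g i m) * β m) = star (τ.tr (star (β m) * g i m)) := by
        let _ := CStarAlgebra.spectralOrder M
        let _ := CStarAlgebra.spectralOrderedRing M
        have : star (τ.tr (star (β m) * g i m)) = τ.tr (star (star (β m) * g i m)) :=
          (map_star τ.positiveTrace (star (β m) * g i m)).symm
        rw [this, star_mul, star_star]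
      rw [h3]; rfl
    rw [twoNorm_sq τ.tr_nonneg, star_sub, sub_mul, mul_sub, mul_sub]
    simp only [map_sub, Complex.sub_re]
    rw [← twoNorm_sq τ.tr_nonneg, ← twoNorm_sq τ.tr_nonneg, hM.twoNorm_apply, hM.twoNorm_apply, hc,
      hn, hφa]
    ring
  have h3 : Tendsto (fun i => twoNorm τ.tr (g i m - β m) ^ 2) l (𝓝 0) := by
    simp only [key]
    have := (((Complex.continuous_re.tendsto _).comp h2).const_mul 2).const_sub (2 * (φ (β m)).re)
    simpa using this
  simpa [Real.sqrt_sq (twoNorm_nonneg _ _)] using h3.sqrt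

theorem IsII1Factor.tendsto_uTopology (hM : τ.IsII1Factor)
    (h : ∀ m, Tendsto (fun i => twoNorm τ.tr ((g i).symm m - β.symm m)) l (𝓝 0)) :
    Tendsto g l (@nhds _ τ.uTopology β) := by
  let _ := CStarAlgebra.spectralOrder M
  let _ := CStarAlgebra.spectralOrderedRing M
  rw [tendsto_uTopology_iff]
  rintro φ ⟨ξ, η, hξ, hη, hφ⟩
  refine PositiveLinearMap.mem_of_hasSum_inner τ.positiveTrace
    (S := {φ | Tendsto (fun i => precomp φ (g i)) l (𝓝 (precomp φ β))}) ?_ ?_ ?_ ?_ hξ hη hφ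
  · refine isClosed_of_closure_subset fun φ hφ => ?_
    refine Metric.tendsto_nhds.mpr fun ε hε => ?_
    obtain ⟨ψ, hψ, hd⟩ := Metric.mem_closure_iff.mp hφ (ε / 3) (by positivity)
    filter_upwards [Metric.tendsto_nhds.mp hψ (ε / 3) (by positivity)] with i hi
    have h1 : dist (precomp φ (g i)) (precomp ψ (g i)) ≤ dist φ ψ := by
      rw [dist_eq_norm, dist_eq_norm]; exact norm_precomp_sub_le _ _ _
    have h2 : dist (precomp ψ β) (precomp φ β) ≤ dist φ ψ := by
      rw [dist_comm, dist_eq_norm, dist_eq_norm]; exact norm_precomp_sub_le _ _ _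
    have h3 := dist_triangle4 (precomp φ (g i)) (precomp ψ (g i)) (precomp ψ β) (precomp φ β)
    linarith
  · exact tendsto_const_nhds
  · intro φ hφ ψ hψ
    exact Tendsto.add hφ hψ
  · intro y z
    refine tendsto_iff_norm_sub_tendsto_zero.mpr ?_
    refine squeeze_zero (fun _ => norm_nonneg _) (fun i => ?_) (h (z * star y))
    refine ContinuousLinearMap.opNorm_le_bound _ (twoNorm_nonneg _ _) fun a => ?_
    have hev : ∀ α : M ≃⋆ₐ[ℂ] M, precomp (τ.positiveTrace.vectorFunctional
        (τ.positiveTrace.toPreGNS y : τ.positiveTrace.GNS)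
        (τ.positiveTrace.toPreGNS z : τ.positiveTrace.GNS)) α a =
          τ.tr (a * α.symm (z * star y)) := by
      intro α
      rw [precomp_apply, PositiveLinearMap.vectorFunctional_coe]
      change τ.tr _ = _
      rw [τ.tr_mul_comm, mul_assoc, ← hM.tr_apply α (a * _), map_mul α, StarAlgEquiv.apply_symm_apply]
    rw [sub_apply, hev, hev, ← map_sub, ← mul_sub]
    have := norm_apply_star_mul_le τ.tr τ.tr_nonneg (star a)
      ((g i).symm (z * star y) - β.symm (z * star y))
    rw [star_star] at this
    refine this.trans ?_
    rw [mul_comm]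
    gcongr
    · exact twoNorm_nonneg _ _
    · simpa using τ.twoNorm_le_norm (star a)

end TracialVNA

/-! ## Extending maps into contractible spaces -/

/-- A continuous map into a contractible space, defined on the part of a closed set `S` inside `B`,
agrees near a closed subset of the interior of `B` with a continuous map defined on all of `S`. -/
theorem exists_continuousOn_extension_of_contractible {X G : Type*} [TopologicalSpace X]
    [NormalSpace X] [TopologicalSpace G] [ContractibleSpace G] {S B B' : Set X}
    (hS : IsClosed S) (hB : IsClosed B) (hB' : IsClosed B') (hBB' : B' ⊆ interior B) {g : X → G}
    (hg : ContinuousOn g (S ∩ B)) :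
    ∃ g' : X → G, ContinuousOn g' S ∧ ∀ x ∈ B', g' x = g x := by
  classical
  obtain ⟨c, ⟨H⟩⟩ := id_nullhomotopic G
  obtain ⟨u, hu0, hu1, hu⟩ := exists_continuous_zero_one_of_isClosed hB'
    isOpen_interior.isClosed_compl (Set.disjoint_compl_right_iff_subset.mpr hBB')
  let v : X → unitInterval := fun x => ⟨u x, hu x⟩
  have hv : Continuous v := u.continuous.subtype_mk _
  refine ⟨fun x => if x ∈ B then H (v x, g x) else c, ?_, fun x hx => ?_⟩
  · have h1 : ContinuousOn (fun x => if x ∈ B then H (v x, g x) else c) (S ∩ B) := by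
      refine ContinuousOn.congr (f := fun x => H (v x, g x)) ?_ fun x hx => if_pos hx.2
      exact H.continuous.comp_continuousOn (hv.continuousOn.prodMk hg)
    have h2 : ContinuousOn (fun x => if x ∈ B then H (v x, g x) else c) (S ∩ (interior B)ᶜ) := by
      refine (continuousOn_const (c := c)).congr fun x hx => ?_
      have : v x = 1 := Subtype.ext (hu1 hx.2)
      dsimp only
      rw [this, H.apply_one]
      exact ite_self _
    refine (h1.union_of_isClosed h2 (hS.inter hB)
      (hS.inter isOpen_interior.isClosed_compl)).mono fun x hx => ?_
    by_cases hxB : x ∈ B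
    · exact Or.inl ⟨hx, hxB⟩
    · exact Or.inr ⟨hx, fun h => hxB (interior_subset h)⟩
  · have : v x = 0 := Subtype.ext (hu0 hx)
    dsimp only
    rw [if_pos (interior_subset (hBB' hx)), this, H.apply_zero]
    rfl

/-- Surjective *-homomorphisms with the same kernel have isomorphic ranges. -/
theorem exists_starAlgEquiv_of_ker_eq {A M N : Type*} [Ring A] [StarRing A] [Algebra ℂ A]
    [Ring M] [StarRing M] [Algebra ℂ M] [Ring N] [StarRing N] [Algebra ℂ N]
    (p : A →⋆ₐ[ℂ] M) (q : A →⋆ₐ[ℂ] N) (hp : Function.Surjective p) (hq : Function.Surjective q)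
    (h : ∀ a, p a = 0 ↔ q a = 0) : ∃ e : M ≃⋆ₐ[ℂ] N, ∀ a, e (p a) = q a := by
  have heq : ∀ a b, p a = p b ↔ q a = q b := fun a b => by
    rw [← sub_eq_zero, ← map_sub, h, map_sub, sub_eq_zero]
  let s := Function.surjInv hp
  have hs : ∀ m, p (s m) = m := Function.surjInv_eq hp
  have hqs : ∀ a, q (s (p a)) = q a := fun a => (heq _ _).mp (hs _)
  let e : M →⋆ₐ[ℂ] N :=
    { toFun := fun m => q (s m)
      map_one' := by rw [← map_one q, ← heq, hs, map_one]
      map_mul' := fun m n => by rw [← map_mul, ← heq, map_mul, hs, hs, hs]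
      map_zero' := by rw [← map_zero q, ← heq, hs, map_zero]
      map_add' := fun m n => by rw [← map_add, ← heq, map_add, hs, hs, hs]
      commutes' := fun c => by
        rw [← AlgHomClass.commutes q, ← heq, hs, AlgHomClass.commutes]
      map_star' := fun m => by rw [← map_star, ← heq, map_star, hs, hs] }
  have he : ∀ a, e (p a) = q a := hqs
  refine ⟨StarAlgEquiv.ofBijective e ⟨fun m n hmn => ?_, fun n => ?_⟩, he⟩
  · rw [← hs m, ← hs n, heq]
    exact hmn
  · obtain ⟨a, rfl⟩ := hq n
    exact ⟨p a, he a⟩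

/-! ## Trivialisations -/

namespace WStarBundle

variable {X A : Type*} [TopologicalSpace X] [CompactSpace X] [T2Space X] [CStarAlgebra A]
  {M : Type*} [CStarAlgebra M]

/-- A trivialisation of the bundle `𝓜` over the subset `Y`, with fibre `(M, τ)`: a family of
trace-preserving identifications `θ x` of the fibres `𝓜_x`, for `x ∈ Y`, with `M`, such that all
sections become `‖·‖₂`-continuous functions `Y → M`. -/
structure IsTrivialization (𝓜 : WStarBundle X A) (τ : TracialVNA M) (Y : Set X)
    (θ : X → A →⋆ₐ[ℂ] M) : Prop where
  surjective : ∀ x ∈ Y, Function.Surjective (θ x)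
  tr_apply : ∀ x ∈ Y, ∀ a, τ.tr (θ x a) = 𝓜.E a x
  tendsto : ∀ a, ∀ x ∈ Y, Tendsto (fun y => twoNorm τ.tr (θ y a - θ x a)) (𝓝[Y] x) (𝓝 0)

namespace IsTrivialization

variable {𝓜 : WStarBundle X A} {τ : TracialVNA M} {Y Z : Set X} {θ θ' : X → A →⋆ₐ[ℂ] M}

theorem mono (h : 𝓜.IsTrivialization τ Y θ) (hZ : Z ⊆ Y) : 𝓜.IsTrivialization τ Z θ where
  surjective x hx := h.surjective x (hZ hx)
  tr_apply x hx := h.tr_apply x (hZ hx)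
  tendsto a x hx := (h.tendsto a x (hZ hx)).mono_left (nhdsWithin_mono x hZ)

theorem congr (h : 𝓜.IsTrivialization τ Y θ) (hθ : ∀ x ∈ Y, θ' x = θ x) :
    𝓜.IsTrivialization τ Y θ' where
  surjective x hx := by rw [hθ x hx]; exact h.surjective x hx
  tr_apply x hx := by rw [hθ x hx]; exact h.tr_apply x hx
  tendsto a x hx := by
    refine (h.tendsto a x hx).congr' ?_
    filter_upwards [self_mem_nhdsWithin] with y hy
    rw [hθ x hx, hθ y hy]

theorem union (hY : 𝓜.IsTrivialization τ Y θ) (hZ : 𝓜.IsTrivialization τ Z θ)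
    (hYc : IsClosed Y) (hZc : IsClosed Z) : 𝓜.IsTrivialization τ (Y ∪ Z) θ where
  surjective x hx := hx.elim (hY.surjective x) (hZ.surjective x)
  tr_apply x hx := hx.elim (hY.tr_apply x) (hZ.tr_apply x)
  tendsto a x _ := by
    have key : ∀ {W : Set X}, IsClosed W → 𝓜.IsTrivialization τ W θ →
        Tendsto (fun y => twoNorm τ.tr (θ y a - θ x a)) (𝓝[W] x) (𝓝 0) := by
      intro W hWc hW
      by_cases hx : x ∈ W
      · exact hW.tendsto a x hx
      · rw [notMem_closure_iff_nhdsWithin_eq_bot.mp (by rwa [hWc.closure_eq])]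
        exact tendsto_bot
    rw [nhdsWithin_union]
    exact (key hYc hY).sup (key hZc hZ)

theorem map_eq_zero_iff (h : 𝓜.IsTrivialization τ Y θ) {x : X} (hx : x ∈ Y) (a : A) :
    θ x a = 0 ↔ 𝓜.E (star a * a) x = 0 := by
  rw [← h.tr_apply x hx, map_mul, map_star]
  exact ⟨fun h0 => by simp [h0], τ.faithful _⟩

theorem twoNorm_apply (h : 𝓜.IsTrivialization τ Y θ) {x : X} (hx : x ∈ Y) (a : A) :
    twoNorm τ.tr (θ x a) = √(𝓜.E (star a * a) x).re := by
  rw [twoNorm, ← map_star, ← map_mul, h.tr_apply x hx]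

theorem map_ι (h : 𝓜.IsTrivialization τ Y θ) {x : X} (hx : x ∈ Y) (f : C(X, ℂ)) :
    θ x (𝓜.ι f) = algebraMap ℂ M (f x) := by
  have h0 : θ x (𝓜.ι (f - algebraMap ℂ C(X, ℂ) (f x))) = 0 := by
    rw [h.map_eq_zero_iff hx, ← map_star, ← map_mul, 𝓜.E_ι]
    simp
  rw [map_sub, map_sub, AlgHomClass.commutes, AlgHomClass.commutes, sub_eq_zero] at h0
  exact h0

theorem exists_transition (h : 𝓜.IsTrivialization τ Y θ) (h' : 𝓜.IsTrivialization τ Z θ') {x : X}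
    (hx : x ∈ Y ∩ Z) : ∃ g : M ≃⋆ₐ[ℂ] M, ∀ a, g (θ x a) = θ' x a :=
  exists_starAlgEquiv_of_ker_eq _ _ (h.surjective x hx.1) (h'.surjective x hx.2) fun a => by
    rw [h.map_eq_zero_iff hx.1, h'.map_eq_zero_iff hx.2]

theorem tendsto_transition (hM : τ.IsII1Factor) (h : 𝓜.IsTrivialization τ Y θ)
    (h' : 𝓜.IsTrivialization τ Y θ') {g : X → M ≃⋆ₐ[ℂ] M}
    (hg : ∀ x ∈ Y, ∀ a, g x (θ x a) = θ' x a) {x : X} (hx : x ∈ Y) (m : M) :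
    Tendsto (fun y => twoNorm τ.tr (g y m - g x m)) (𝓝[Y] x) (𝓝 0) := by
  obtain ⟨a, rfl⟩ := h.surjective x hx m
  have hlim := (h.tendsto a x hx).add (h'.tendsto a x hx)
  rw [add_zero] at hlim
  refine squeeze_zero' (Eventually.of_forall fun _ => twoNorm_nonneg _ _) ?_ hlim
  filter_upwards [self_mem_nhdsWithin] with y hy
  refine (twoNorm_sub_le τ.tr_nonneg _ (g y (θ y a)) _).trans (add_le_add (le_of_eq ?_) ?_)
  · rw [← map_sub, hM.twoNorm_apply, twoNorm_sub_comm]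
  · rw [hg y hy, hg x hx]

theorem continuousOn_transition (hM : τ.IsII1Factor) (h : 𝓜.IsTrivialization τ Y θ)
    (h' : 𝓜.IsTrivialization τ Y θ') {g : X → M ≃⋆ₐ[ℂ] M}
    (hg : ∀ x ∈ Y, ∀ a, g x (θ x a) = θ' x a) :
    @ContinuousOn _ _ _ τ.uTopology g Y := by
  let _ := τ.uTopology
  intro x hx
  refine hM.tendsto_uTopology fun m => ?_
  refine tendsto_transition hM h' h (g := fun x => (g x).symm) (fun y hy a => ?_) hx m
  rw [← hg y hy, StarAlgEquiv.symm_apply_apply]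

theorem comp (hM : τ.IsII1Factor) (h : 𝓜.IsTrivialization τ Y θ) {g : X → M ≃⋆ₐ[ℂ] M}
    (hg : @ContinuousOn _ _ _ τ.uTopology g Y) :
    𝓜.IsTrivialization τ Y fun x => ((g x : M →⋆ₐ[ℂ] M)).comp (θ x) where
  surjective x hx := (g x).surjective.comp (h.surjective x hx)
  tr_apply x hx a := (hM.tr_apply (g x) _).trans (h.tr_apply x hx a)
  tendsto a x hx := by
    have h1 := hM.tendsto_twoNorm_of_tendsto (hg x hx) (θ x a)
    have h2 := (h.tendsto a x hx).add h1
    rw [add_zero] at h2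
    refine squeeze_zero (fun _ => twoNorm_nonneg _ _) (fun y => ?_) h2
    refine (twoNorm_sub_le τ.tr_nonneg _ (g y (θ x a)) _).trans (add_le_add (le_of_eq ?_) le_rfl)
    change twoNorm τ.tr (g y (θ y a) - g y (θ x a)) = _
    rw [← map_sub, hM.twoNorm_apply]

/-- Gluing of trivialisations when `Aut(M)` is contractible. -/
theorem exists_glue (hM : τ.IsII1Factor) (hAut : @ContractibleSpace (M ≃⋆ₐ[ℂ] M) τ.uTopology)
    {S B B' : Set X} (hS : IsClosed S) (hB : IsClosed B) (hB' : IsClosed B')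
    (hBB' : B' ⊆ interior B) (h : 𝓜.IsTrivialization τ S θ) (h' : 𝓜.IsTrivialization τ B θ') :
    ∃ θ'', 𝓜.IsTrivialization τ (S ∪ B') θ'' := by
  classical
  have hex : ∀ x, ∃ g : M ≃⋆ₐ[ℂ] M, x ∈ S ∩ B → ∀ a, g (θ x a) = θ' x a := fun x => by
    by_cases hx : x ∈ S ∩ B
    · obtain ⟨g, hg⟩ := h.exists_transition h' hx
      exact ⟨g, fun _ => hg⟩
    · exact ⟨StarAlgEquiv.refl _ _, fun hx' => absurd hx' hx⟩
  choose g hg using hex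
  have hcont := continuousOn_transition hM (h.mono Set.inter_subset_left)
    (h'.mono Set.inter_subset_right) hg
  let _ := τ.uTopology
  obtain ⟨g', hg'c, hg'⟩ := exists_continuousOn_extension_of_contractible hS hB hB' hBB' hcont
  have hθ := h.comp hM hg'c
  refine ⟨fun x => if x ∈ B' then θ' x else ((g' x : M →⋆ₐ[ℂ] M)).comp (θ x),
    union (hθ.congr fun x hx => ?_) ((h'.mono (hBB'.trans interior_subset)).congr fun x hx => ?_)
      hS hB'⟩
  · split_ifs with hxB
    · ext a
      change _ = g' x (θ x a)
      rw [hg' x hxB, hg x ⟨hx, interior_subset (hBB' hxB)⟩]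
    · rfl
  · exact if_pos hx

/-- If the bundle is locally trivial with fibre `M` and `Aut(M)` is contractible, it is trivial. -/
theorem exists_univ (hM : τ.IsII1Factor) (hAut : @ContractibleSpace (M ≃⋆ₐ[ℂ] M) τ.uTopology)
    (hne : X → Nonempty (A →⋆ₐ[ℂ] M))
    (hloc : ∀ x, ∃ Y ∈ 𝓝 x, IsClosed Y ∧ ∃ θ, 𝓜.IsTrivialization τ Y θ) :
    ∃ θ, 𝓜.IsTrivialization τ Set.univ θ := by
  choose Y hY hYc θ hθ using hloc
  have hsm : ∀ x, ∃ B' ∈ 𝓝 x, IsClosed B' ∧ B' ⊆ interior (Y x) := fun x =>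
    exists_mem_nhds_isClosed_subset (interior_mem_nhds.mpr (hY x))
  choose B' hB' hB'c hB'Y using hsm
  obtain ⟨t, -, ht⟩ := isCompact_univ.elim_nhds_subcover B' fun x _ => hB' x
  suffices H : ∀ t : Finset X, ∃ θ, 𝓜.IsTrivialization τ (⋃ x ∈ t, B' x) θ by
    obtain ⟨θ, h⟩ := H t
    exact ⟨θ, h.mono ht⟩
  intro t
  classical
  induction t using Finset.induction_on with
  | empty =>
    refine ⟨fun x => (hne x).some, ⟨?_, ?_, ?_⟩⟩ <;> simp
  | insert x t _ ih =>
    obtain ⟨θ', h⟩ := ih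
    rw [Finset.set_biUnion_insert, Set.union_comm]
    exact exists_glue hM hAut (t.finite_toSet.isClosed_biUnion fun x _ => hB'c x) (hYc x) (hB'c x)
      (hB'Y x) h (hθ x)

end IsTrivialization

end WStarBundle

/-! ## Isomorphisms of bundles and their base maps -/

open WeakDual.CharacterSpace in
/-- A unital *-homomorphism between algebras of continuous functions is a composition operator. -/
theorem exists_continuousMap_of_starAlgHom {X₁ X₂ : Type*} [TopologicalSpace X₁] [CompactSpace X₁]
    [T2Space X₁] [TopologicalSpace X₂] [CompactSpace X₂] [T2Space X₂]
    (σ : C(X₁, ℂ) →⋆ₐ[ℂ] C(X₂, ℂ)) : ∃ s : C(X₂, X₁), ∀ f y, σ f y = f (s y) := by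
  refine ⟨⟨fun y => (homeoEval X₁ ℂ).symm (compContinuousMap σ (homeoEval X₂ ℂ y)),
    (homeoEval X₁ ℂ).symm.continuous.comp
      ((compContinuousMap σ).continuous.comp (homeoEval X₂ ℂ).continuous)⟩, fun f y => ?_⟩
  have h : homeoEval X₁ ℂ ((homeoEval X₁ ℂ).symm (compContinuousMap σ (homeoEval X₂ ℂ y))) =
    compContinuousMap σ (homeoEval X₂ ℂ y) := Homeomorph.apply_symm_apply _ _
  exact (DFunLike.congr_fun h f).symm

namespace BundleData

variable {X₁ A₁ X₂ A₂ : Type*} [TopologicalSpace X₁] [Ring A₁] [StarRing A₁] [Algebra ℂ A₁]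
  [TopologicalSpace X₂] [Ring A₂] [StarRing A₂] [Algebra ℂ A₂]
  {D₁ : BundleData X₁ A₁} {D₂ : BundleData X₂ A₂}

/-- The map of base algebras underlying a morphism of bundles. -/
theorem IsMorphism.exists_baseHom {α : A₁ →⋆ₐ[ℂ] A₂} (hα : IsMorphism D₁ D₂ α)
    (h₂ : ∀ f, D₂.E (D₂.ι f) = f) :
    ∃ σ : C(X₁, ℂ) →⋆ₐ[ℂ] C(X₂, ℂ), ∀ a, σ (D₁.E a) = D₂.E (α a) := by
  have hinj : Function.Injective D₂.ι := Function.LeftInverse.injective h₂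
  choose s hs using hα.map_base
  refine ⟨{ toFun := s
            map_one' := hinj (by rw [← hs, map_one, map_one, map_one])
            map_mul' := fun f g => hinj (by rw [← hs, map_mul, map_mul, map_mul, hs, hs])
            map_zero' := hinj (by rw [← hs, map_zero, map_zero, map_zero])
            map_add' := fun f g => hinj (by rw [← hs, map_add, map_add, map_add, hs, hs])
            commutes' := fun c => hinj (by rw [← hs]; simp only [AlgHomClass.commutes])
            map_star' := fun f => hinj (by rw [← hs, map_star, map_star, map_star, hs]) },
    fun a => hinj ?_⟩
  exact (hs _).symm.trans (hα.map_E a)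

/-- An isomorphism of bundles covers a continuous map of the bases. -/
theorem Isomorphic.exists_baseMap [CompactSpace X₁] [T2Space X₁] [CompactSpace X₂] [T2Space X₂]
    (h : Isomorphic D₁ D₂) (h₁ : ∀ f, D₁.E (D₁.ι f) = f) :
    ∃ (α : A₁ →⋆ₐ[ℂ] A₂) (r : C(X₁, X₂)), Function.Bijective α ∧
      ∀ a x, D₂.E (α a) (r x) = D₁.E a x := by
  obtain ⟨α, β, hα, hβ, hβα, hαβ⟩ := h
  have hβα' : ∀ a, β (α a) = a := DFunLike.congr_fun hβα
  have hαβ' : ∀ a, α (β a) = a := DFunLike.congr_fun hαβ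
  obtain ⟨ρ, hρE⟩ := hβ.exists_baseHom h₁
  obtain ⟨r, hr⟩ := exists_continuousMap_of_starAlgHom ρ
  refine ⟨α, r, ⟨Function.LeftInverse.injective hβα', Function.RightInverse.surjective hαβ'⟩,
    fun a x => ?_⟩
  rw [← hr, hρE, hβα']

end BundleData

/-- Evaluation of sections of the trivial bundle at a point. -/
noncomputable def CSigma.eval {X : Type*} [TopologicalSpace X] {N : Type*}
    [CStarAlgebra N] (τ : TracialVNA N) (x : X) : CSigma X τ →⋆ₐ[ℂ] N where
  toFun f := f.1 x
  map_one' := rfl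
  map_mul' _ _ := rfl
  map_zero' := rfl
  map_add' _ _ := rfl
  commutes' _ := rfl
  map_star' _ := rfl

theorem CSigma.eval_surjective {X : Type*} [TopologicalSpace X] {N : Type*}
    [CStarAlgebra N] (τ : TracialVNA N) (x : X) : Function.Surjective (CSigma.eval τ x) :=
  fun n => ⟨⟨fun _ => n, ⟨‖n‖, fun _ => le_rfl⟩, fun x₀ => by simp [twoNorm_zero]⟩, rfl⟩

namespace WStarBundle

variable {X A : Type*} [TopologicalSpace X] [CompactSpace X] [T2Space X] [CStarAlgebra A]
  (𝓜 : WStarBundle X A)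

/-- The restriction of sections, as a *-homomorphism. -/
noncomputable def toRestr (Y : Set X) : A →⋆ₐ[ℂ] 𝓜.Restr Y where
  toFun := Ideal.Quotient.mk (𝓜.idealOn Y)
  map_one' := map_one _
  map_mul' := map_mul _
  map_zero' := map_zero _
  map_add' := map_add _
  commutes' _ := rfl
  map_star' _ := rfl

theorem toRestr_surjective (Y : Set X) : Function.Surjective (𝓜.toRestr Y) :=
  Ideal.Quotient.mk_surjective

theorem toRestr_singleton_eq_zero_iff (x : X) (a : A) :
    𝓜.toRestr {x} a = 0 ↔ 𝓜.E (star a * a) x = 0 := by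
  change Ideal.Quotient.mk (𝓜.idealOn {x}) a = 0 ↔ _
  rw [Ideal.Quotient.eq_zero_iff_mem, mem_idealOn]
  simp

theorem restrict_E_toRestr (Y : Closeds X) (a : A) (y : Y) :
    (𝓜.restrict Y).E (𝓜.toRestr Y a) y = 𝓜.E a y := rfl

theorem restrict_E_ι (Y : Closeds X) (f : C(Y, ℂ)) :
    (𝓜.restrict Y).E ((𝓜.restrict Y).ι f) = f := by
  ext y
  change 𝓜.E (𝓜.ι (extend Y f)) y = f y
  rw [𝓜.E_ι, extend_apply]

variable {𝓜} {M : Type*} [CStarAlgebra M] {τ : TracialVNA M}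

/-- Local triviality, with the fibre of the local trivial bundles identified with `M`. -/
theorem exists_isTrivialization_of_isomorphic (hM : τ.IsII1Factor)
    (hfib : ∀ x, Nonempty (𝓜.Fibre x ≃⋆ₐ[ℂ] M)) {Y : Closeds X} {x₀ : X} (hx₀ : x₀ ∈ Y)
    {N : Type*} [CStarAlgebra N] {τN : TracialVNA N}
    (h : (𝓜.restrict Y).Isomorphic (trivialBundle Y τN)) :
    ∃ θ, 𝓜.IsTrivialization τ Y θ := by
  classical
  obtain ⟨α, r, hα, hr⟩ := h.exists_baseMap (𝓜.restrict_E_ι Y)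
  let p : Y → A →⋆ₐ[ℂ] N := fun y => (CSigma.eval τN (r y)).comp (α.comp (𝓜.toRestr Y))
  have hp : ∀ y, Function.Surjective (p y) := fun y =>
    (CSigma.eval_surjective τN (r y)).comp (hα.surjective.comp (𝓜.toRestr_surjective Y))
  have hptr : ∀ y a, τN.tr (p y a) = 𝓜.E a y := fun y a => by
    rw [← restrict_E_toRestr, ← hr]
    rfl
  obtain ⟨e₀⟩ := hfib x₀
  let q : A →⋆ₐ[ℂ] M := (e₀ : 𝓜.Fibre x₀ →⋆ₐ[ℂ] M).comp (𝓜.toRestr {x₀})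
  obtain ⟨e, he⟩ := exists_starAlgEquiv_of_ker_eq (p ⟨x₀, hx₀⟩) q (hp _)
    (e₀.surjective.comp (𝓜.toRestr_surjective _)) fun a => by
      have hq : q a = 0 ↔ 𝓜.E (star a * a) x₀ = 0 := by
        rw [← toRestr_singleton_eq_zero_iff]
        exact map_eq_zero_iff e₀ e₀.injective
      rw [hq, ← hptr ⟨x₀, hx₀⟩, map_mul, map_star]
      exact ⟨fun h0 => by simp [h0], τN.faithful _⟩
  have hetr : ∀ n, τ.tr (e n) = τN.tr n := fun n => by
    rw [← hM.tr_unique (τN.comap e.symm), TracialVNA.comap_tr, StarAlgEquiv.symm_apply_apply]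
  have henorm : ∀ n, twoNorm τ.tr (e n) = twoNorm τN.tr n := fun n => by
    rw [twoNorm, ← map_star, ← map_mul, hetr, twoNorm]
  let θ : X → A →⋆ₐ[ℂ] M := fun x =>
    if hx : x ∈ Y then (e : N →⋆ₐ[ℂ] M).comp (p ⟨x, hx⟩) else q
  have hθ : ∀ (y : Y) a, θ y a = e (p y a) := fun y a => by
    simp only [θ, dif_pos y.2]
    rfl
  refine ⟨θ, ⟨fun x hx m => ?_, fun x hx a => ?_, fun a x hx => ?_⟩⟩
  · obtain ⟨n, rfl⟩ := e.surjective m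
    obtain ⟨a, rfl⟩ := hp ⟨x, hx⟩ n
    exact ⟨a, hθ ⟨x, hx⟩ a⟩
  · rw [hθ ⟨x, hx⟩ a, hetr, hptr]
  · lift x to Y using hx
    rw [nhdsWithin_eq_map_subtype_coe x.2, tendsto_map'_iff]
    have h1 := ((α (𝓜.toRestr Y a)).2.2 (r x)).comp (r.continuous.tendsto x)
    refine h1.congr fun y => ?_
    simp only [Function.comp_apply]
    rw [hθ, hθ, ← map_sub, henorm]
    rfl

end WStarBundle

/-! ## Globally trivialised bundles -/

/-- The norm of an element is controlled by its images under a faithful family of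
*-homomorphisms. -/
theorem norm_le_of_forall_norm_map_le {I A M : Type*} [CStarAlgebra A] [CStarAlgebra M]
    (θ : I → A →⋆ₐ[ℂ] M) (hθ : ∀ a, (∀ i, θ i a = 0) → a = 0) {a : A} {C : ℝ} (hC : 0 ≤ C)
    (h : ∀ i, ‖θ i a‖ ≤ C) : ‖a‖ ≤ C := by
  let _ : TopologicalSpace I := ⊥
  have _ : DiscreteTopology I := ⟨rfl⟩
  let Φ : A →⋆ₐ[ℂ] BoundedContinuousFunction I M :=
    { toFun := fun a => BoundedContinuousFunction.ofNormedAddCommGroupDiscrete (fun i => θ i a) ‖a‖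
        fun i => NonUnitalStarAlgHom.norm_apply_le (θ i) a
      map_one' := by ext i; exact map_one (θ i)
      map_mul' := fun a b => by ext i; exact map_mul (θ i) a b
      map_zero' := by ext i; exact map_zero (θ i)
      map_add' := fun a b => by ext i; exact map_add (θ i) a b
      commutes' := fun c => by ext i; exact AlgHomClass.commutes (θ i) c
      map_star' := fun a => by ext i; exact map_star (θ i) a }
  have hΦ : ∀ a i, Φ a i = θ i a := fun a i => rfl
  have hinj : Function.Injective Φ := by
    refine (injective_iff_map_eq_zero Φ).mpr fun b hb => hθ b fun i => ?_
    rw [← hΦ, hb]; rfl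
  rw [← NonUnitalStarAlgHom.norm_map Φ hinj, BoundedContinuousFunction.norm_le hC]
  exact h

/-- Elements lift along surjective *-homomorphisms of C*-algebras without increasing a given bound on
the norm. -/
theorem exists_lift_norm_le {A M : Type*} [CStarAlgebra A] [CStarAlgebra M] (θ : A →⋆ₐ[ℂ] M)
    (hθ : Function.Surjective θ) {C : ℝ} (hC : 0 < C) {m : M} (hm : ‖m‖ ≤ C) :
    ∃ a, θ a = m ∧ ‖a‖ ≤ C := by
  let _ := CStarAlgebra.spectralOrder A
  let _ := CStarAlgebra.spectralOrderedRing A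
  obtain ⟨a, rfl⟩ := hθ m
  let h : ℝ → ℝ := fun t => C / max C √t
  have hpos : ∀ t, 0 < max C √t := fun t => lt_max_of_lt_left hC
  have hcont : Continuous h := continuous_const.div (by fun_prop) fun t => (hpos t).ne'
  have hb : IsSelfAdjoint (star a * a) := IsSelfAdjoint.star_mul_self a
  refine ⟨a * cfc h (star a * a), ?_, ?_⟩
  · have h1 : cfc h (star (θ a) * θ a) = 1 := by
      rcases subsingleton_or_nontrivial M with _ | _
      · exact Subsingleton.elim _ _
      have hb' : IsSelfAdjoint (star (θ a) * θ a) := IsSelfAdjoint.star_mul_self _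
      rw [← cfc_one ℝ (star (θ a) * θ a)]
      refine cfc_congr fun t ht => ?_
      have ht1 : ‖t‖ ≤ ‖θ a‖ * ‖θ a‖ := by
        rw [← CStarRing.norm_star_mul_self]
        exact spectrum.norm_le_norm_of_mem ht
      have ht2 : √t ≤ C := by
        refine (Real.sqrt_le_left hC.le).mpr ((le_abs_self t).trans (ht1.trans ?_))
        rw [sq]; gcongr
      simp only [h, Pi.one_apply, max_eq_left ht2]
      exact div_self hC.ne'
    have hc : Continuous θ := AddMonoidHomClass.continuous_of_bound θ 1 fun a => by
      simpa using NonUnitalStarAlgHom.norm_apply_le θ a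
    rw [map_mul, StarAlgHomClass.map_cfc θ h (star a * a) (hφ := hc) (hφa := hb.map θ), map_mul,
      map_star, h1, mul_one]
  · refine (sq_le_sq₀ (norm_nonneg _) hC.le).mp ?_
    rw [sq, ← CStarRing.norm_star_mul_self]
    have e : star (a * cfc h (star a * a)) * (a * cfc h (star a * a)) =
        cfc (fun t => h t * t * h t) (star a * a) := by
      rw [cfc_mul (fun t => h t * t) h _, cfc_mul h (fun t => t) _, cfc_id' ℝ (star a * a), star_mul,
        ← cfc_star]
      simp only [star_trivial, mul_assoc]
    rw [e]
    refine norm_cfc_le (by positivity) fun t ht => ?_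
    have ht0 : 0 ≤ t := spectrum_nonneg_of_nonneg (star_mul_self_nonneg a) ht
    have h1 : h t * √t ≤ C := by
      rw [div_mul_eq_mul_div, div_le_iff₀ (hpos t)]
      exact mul_le_mul_of_nonneg_left (le_max_right _ _) hC.le
    have h2 : h t * t * h t = (h t * √t) ^ 2 := by
      rw [mul_pow, Real.sq_sqrt ht0]; ring
    have h3 : 0 ≤ h t * √t := mul_nonneg (div_nonneg hC.le (hpos t).le) (Real.sqrt_nonneg _)
    rw [h2, Real.norm_of_nonneg (by positivity)]
    exact pow_le_pow_left₀ h3 h1 2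

namespace WStarBundle

variable {X A : Type*} [TopologicalSpace X] [CompactSpace X] [T2Space X] [CStarAlgebra A]
  {𝓜 : WStarBundle X A} {M : Type*} [CStarAlgebra M] {τ : TracialVNA M}

/-- Completeness of the balls of arbitrary radius. -/
theorem exists_limit (𝓜 : WStarBundle X A) {C : ℝ} (hC : 0 < C) (u : ℕ → A) (hu : ∀ n, ‖u n‖ ≤ C)
    (hc : ∀ ε > 0, ∃ n₀, ∀ m ≥ n₀, ∀ n ≥ n₀,
      √‖𝓜.E (star (u m - u n) * (u m - u n))‖ < ε) :
    ∃ a, Tendsto (fun n => √‖𝓜.E (star (u n - a) * (u n - a))‖) atTop (𝓝 0) := by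
  have hs : ∀ (c : ℝ) (a : A), 0 ≤ c → √‖𝓜.E (star ((c : ℂ) • a) * ((c : ℂ) • a))‖ =
      c * √‖𝓜.E (star a * a)‖ := by
    intro c a hc
    rw [star_smul, smul_mul_smul_comm, map_smul, norm_smul, RCLike.star_def, Complex.conj_ofReal,
      norm_mul, Complex.norm_real, Real.norm_of_nonneg hc, Real.sqrt_mul (by positivity),
      Real.sqrt_mul_self hc]
  obtain ⟨a, -, ht⟩ := 𝓜.complete (fun n => ((C⁻¹ : ℝ) : ℂ) • u n)
    (fun n => by
      rw [norm_smul, Complex.norm_real, Real.norm_of_nonneg (by positivity), inv_mul_le_iff₀ hC,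
        mul_one]
      exact hu n)
    (fun ε hε => by
      obtain ⟨n₀, h⟩ := hc (C * ε) (by positivity)
      refine ⟨n₀, fun m hm n hn => ?_⟩
      rw [← smul_sub, hs _ _ (by positivity), inv_mul_lt_iff₀ hC]
      exact h m hm n hn)
  refine ⟨(C : ℂ) • a, ?_⟩
  have := ht.const_mul C
  rw [mul_zero] at this
  refine this.congr fun n => ?_
  rw [← hs _ _ hC.le, smul_sub, smul_smul, ← Complex.ofReal_mul, mul_inv_cancel₀ hC.ne',
    Complex.ofReal_one, one_smul]

namespace IsTrivialization

variable {θ : X → A →⋆ₐ[ℂ] M}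

theorem eq_zero_of_forall (h : 𝓜.IsTrivialization τ Set.univ θ) (a : A)
    (ha : ∀ x, θ x a = 0) : a = 0 := by
  refine 𝓜.faithful a ?_
  ext x
  exact (h.map_eq_zero_iff (Set.mem_univ x) a).mp (ha x)

/-- The identification of the section algebra given by a global trivialisation. -/
noncomputable def toCSigma (h : 𝓜.IsTrivialization τ Set.univ θ) : A →⋆ₐ[ℂ] CSigma X τ where
  toFun a := ⟨fun x => θ x a, ⟨‖a‖, fun x => NonUnitalStarAlgHom.norm_apply_le (θ x) a⟩, fun x => by
    simpa using h.tendsto a x (Set.mem_univ x)⟩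
  map_one' := Subtype.ext (funext fun x => map_one (θ x))
  map_mul' a b := Subtype.ext (funext fun x => map_mul (θ x) a b)
  map_zero' := Subtype.ext (funext fun x => map_zero (θ x))
  map_add' a b := Subtype.ext (funext fun x => map_add (θ x) a b)
  commutes' c := Subtype.ext (funext fun x => AlgHomClass.commutes (θ x) c)
  map_star' a := Subtype.ext (funext fun x => map_star (θ x) a)

theorem toCSigma_apply (h : 𝓜.IsTrivialization τ Set.univ θ) (a : A) (x : X) :
    (h.toCSigma a).1 x = θ x a := rfl

/-- Uniform 2-norm approximation of elements of `C_σ(X, M)` by sections, with norm control. -/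
theorem exists_approx (h : 𝓜.IsTrivialization τ Set.univ θ) (f : CSigma X τ) {C : ℝ} (hC : 0 < C)
    (hf : ∀ x, ‖f.1 x‖ ≤ C) {ε : ℝ} (hε : 0 < ε) :
    ∃ a, ‖a‖ ≤ C ∧ ∀ x, twoNorm τ.tr (θ x a - f.1 x) ≤ ε := by
  classical
  choose a ha haC using fun x => exists_lift_norm_le (θ x) (h.surjective x trivial) hC (hf x)
  have hU : ∀ x, ∀ᶠ y in 𝓝 x, twoNorm τ.tr (θ y (a x) - f.1 y) < ε := fun x => by
    have h1 := h.tendsto (a x) x trivial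
    rw [nhdsWithin_univ] at h1
    have h2 := h1.add (f.2.2 x)
    rw [add_zero] at h2
    rw [ha x] at h2
    filter_upwards [h2.eventually_lt_const hε] with y hy
    refine (twoNorm_sub_le τ.tr_nonneg _ (f.1 x) _).trans_lt ?_
    rwa [twoNorm_sub_comm (f.1 x)]
  obtain ⟨t, ht⟩ := isCompact_univ.elim_nhds_subcover
    (fun x => interior {y | twoNorm τ.tr (θ y (a x) - f.1 y) < ε})
    fun x _ => interior_mem_nhds.mpr (hU x)
  obtain ⟨ρ, hρ⟩ := PartitionOfUnity.exists_isSubordinate (ι := t) isClosed_univ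
    (fun x => interior {y | twoNorm τ.tr (θ y (a x) - f.1 y) < ε}) (fun _ => isOpen_interior)
    (by simpa [Set.iUnion_subtype] using ht.2)
  have hρ1 : ∀ y, ∑ i, ρ i y = 1 := fun y => by
    rw [← finsum_eq_sum_of_fintype]
    exact ρ.sum_eq_one (Set.mem_univ y)
  let F : t → C(X, ℂ) := fun i => ⟨fun x => (ρ i x : ℂ), by fun_prop⟩
  have hθ : ∀ y, θ y (∑ i, 𝓜.ι (F i) * a i) = ∑ i, (ρ i y : ℂ) • θ y (a i) := fun y => by
    rw [map_sum]
    refine Finset.sum_congr rfl fun i _ => ?_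
    rw [map_mul, h.map_ι trivial, ← Algebra.smul_def]
    rfl
  have hnn : ∀ i y, ‖((ρ i y : ℝ) : ℂ)‖ = ρ i y := fun i y => by
    rw [Complex.norm_real, Real.norm_of_nonneg (ρ.nonneg i y)]
  refine ⟨∑ i, 𝓜.ι (F i) * a i, ?_, fun y => ?_⟩
  · refine norm_le_of_forall_norm_map_le θ h.eq_zero_of_forall hC.le fun y => ?_
    rw [hθ]
    refine (norm_sum_le _ _).trans ?_
    calc ∑ i, ‖(ρ i y : ℂ) • θ y (a i)‖ ≤ ∑ i, ρ i y * C := by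
          refine Finset.sum_le_sum fun i _ => ?_
          rw [norm_smul, hnn]
          exact mul_le_mul_of_nonneg_left
            ((NonUnitalStarAlgHom.norm_apply_le (θ y) _).trans (haC i)) (ρ.nonneg i y)
      _ = C := by rw [← Finset.sum_mul, hρ1, one_mul]
  · have e : θ y (∑ i, 𝓜.ι (F i) * a i) - f.1 y = ∑ i, (ρ i y : ℂ) • (θ y (a i) - f.1 y) := by
      simp only [hθ, smul_sub, Finset.sum_sub_distrib]
      rw [← Finset.sum_smul, ← Complex.ofReal_sum, hρ1, Complex.ofReal_one, one_smul]
    rw [e]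
    refine (twoNorm_sum_le τ.tr_nonneg _ _).trans ?_
    calc ∑ i, twoNorm τ.tr ((ρ i y : ℂ) • (θ y (a i) - f.1 y)) ≤ ∑ i, ρ i y * ε := by
          refine Finset.sum_le_sum fun i _ => ?_
          rw [twoNorm_smul, hnn]
          by_cases hy : ρ i y = 0
          · simp [hy]
          · have : y ∈ interior {y | twoNorm τ.tr (θ y (a i) - f.1 y) < ε} :=
              hρ i (subset_tsupport _ hy)
            exact mul_le_mul_of_nonneg_left (interior_subset this).le (ρ.nonneg i y)
      _ = ε := by rw [← Finset.sum_mul, hρ1, one_mul]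

theorem sqrt_norm_E_le (h : 𝓜.IsTrivialization τ Set.univ θ) {a : A} {C : ℝ} (hC : 0 ≤ C)
    (ha : ∀ x, twoNorm τ.tr (θ x a) ≤ C) : √‖𝓜.E (star a * a)‖ ≤ C := by
  refine (Real.sqrt_le_left hC).mpr ((ContinuousMap.norm_le _ (by positivity)).mpr fun x => ?_)
  have h1 := 𝓜.E_nonneg a x
  rw [← Complex.re_eq_norm.mpr h1, ← h.tr_apply x trivial, map_mul, map_star, ← twoNorm_sq τ.tr_nonneg]
  exact pow_le_pow_left₀ (twoNorm_nonneg _ _) (ha x) 2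

theorem twoNorm_le_sqrt_norm_E (h : 𝓜.IsTrivialization τ Set.univ θ) (a : A) (x : X) :
    twoNorm τ.tr (θ x a) ≤ √‖𝓜.E (star a * a)‖ := by
  rw [h.twoNorm_apply trivial]
  exact Real.sqrt_le_sqrt ((Complex.re_le_norm _).trans (ContinuousMap.norm_coe_le_norm _ x))

theorem toCSigma_bijective (h : 𝓜.IsTrivialization τ Set.univ θ) :
    Function.Bijective h.toCSigma := by
  constructor
  · refine (injective_iff_map_eq_zero _).mpr fun a ha => h.eq_zero_of_forall a fun x => ?_
    rw [← h.toCSigma_apply, ha]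
    rfl
  · intro f
    obtain ⟨C₀, hC₀⟩ := f.2.1
    set C := max C₀ 1
    have hC : 0 < C := lt_max_of_lt_right one_pos
    have hlim0 := tendsto_one_div_add_atTop_nhds_zero_nat (𝕜 := ℝ)
    choose u huC hu using fun n : ℕ => h.exists_approx f hC
      (fun x => (hC₀ x).trans (le_max_left _ _)) (ε := 1 / ((n : ℝ) + 1)) (by positivity)
    obtain ⟨a, ha⟩ := 𝓜.exists_limit hC u huC fun ε hε => by
      obtain ⟨n₀, hn₀⟩ := eventually_atTop.mp
        (hlim0.eventually_lt_const (show (0 : ℝ) < ε / 3 by positivity))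
      refine ⟨n₀, fun m hm n hn => (h.sqrt_norm_E_le (C := ε / 3 + ε / 3) (by positivity)
        fun x => ?_).trans_lt (by linarith)⟩
      rw [map_sub]
      refine (twoNorm_sub_le τ.tr_nonneg _ (f.1 x) _).trans (add_le_add ?_ ?_)
      · exact (hu m x).trans (hn₀ m hm).le
      · rw [twoNorm_sub_comm]
        exact (hu n x).trans (hn₀ n hn).le
    refine ⟨a, Subtype.ext (funext fun x => ?_)⟩
    rw [toCSigma_apply, ← sub_eq_zero]
    apply τ.eq_zero_of_twoNorm_eq_zero
    refine le_antisymm ?_ (twoNorm_nonneg _ _)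
    have hsum := ha.add hlim0
    rw [add_zero] at hsum
    refine ge_of_tendsto' hsum fun n => ?_
    refine (twoNorm_sub_le τ.tr_nonneg _ (θ x (u n)) _).trans (add_le_add ?_ (hu n x))
    rw [twoNorm_sub_comm, ← map_sub]
    exact h.twoNorm_le_sqrt_norm_E _ x

theorem isomorphic_trivialBundle (h : 𝓜.IsTrivialization τ Set.univ θ) :
    𝓜.toBundleData.Isomorphic (trivialBundle X τ) := by
  let e := StarAlgEquiv.ofBijective h.toCSigma h.toCSigma_bijective
  have hι : ∀ f, h.toCSigma (𝓜.ι f) = (trivialBundle X τ).ι f := fun f =>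
    Subtype.ext (funext fun x => h.map_ι trivial f)
  have hE : ∀ a, (trivialBundle X τ).E (h.toCSigma a) = 𝓜.E a := fun a =>
    ContinuousMap.ext fun x => h.tr_apply x trivial a
  have he : ∀ a, e a = h.toCSigma a := fun a => rfl
  have hι' : ∀ f, e.symm ((trivialBundle X τ).ι f) = 𝓜.ι f := fun f => by
    rw [← hι, ← he, StarAlgEquiv.symm_apply_apply]
  have hE' : ∀ b, 𝓜.E (e.symm b) = (trivialBundle X τ).E b := fun b => by
    rw [← hE, ← he, StarAlgEquiv.apply_symm_apply]
  refine ⟨h.toCSigma, (e.symm : CSigma X τ →⋆ₐ[ℂ] A), ⟨fun f => ⟨f, hι f⟩, fun a => ?_⟩,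
    ⟨fun f => ⟨f, hι' f⟩, fun b => ?_⟩, ?_, ?_⟩
  · rw [hι, hE]
  · exact (hι' _).trans (congrArg 𝓜.ι (hE' b).symm)
  · exact StarAlgHom.ext fun a => e.symm_apply_apply a
  · exact StarAlgHom.ext fun b => e.apply_symm_apply b

end IsTrivialization

end WStarBundle

theorem corollary4p8 {X : Type*} [TopologicalSpace X] [CompactSpace X] [T2Space X]
    {A : Type*} [CStarAlgebra A] (𝓜 : WStarBundle X A)
    {M : Type*} [CStarAlgebra M] (τ : TracialVNA M) (hM : τ.IsII1Factor)
    (hAut : @ContractibleSpace (M ≃⋆ₐ[ℂ] M) τ.uTopology)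
    (hloc : 𝓜.IsLocallyTrivial)
    (hfib : ∀ x, Nonempty (𝓜.Fibre x ≃⋆ₐ[ℂ] M)) :
    𝓜.toBundleData.Isomorphic (trivialBundle X τ) := by
  obtain ⟨θ, h⟩ := WStarBundle.IsTrivialization.exists_univ (𝓜 := 𝓜) hM hAut
    (fun x => (hfib x).elim fun e => ⟨(e : 𝓜.Fibre x →⋆ₐ[ℂ] M).comp (𝓜.toRestr {x})⟩) fun x => by
      obtain ⟨Y, hY, N, _, τN, hiso⟩ := hloc x
      exact ⟨Y, hY, Y.isClosed,
        WStarBundle.exists_isTrivialization_of_isomorphic hM hfib (mem_of_mem_nhds hY) hiso⟩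
  exact h.isomorphic_trivialBundle
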